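/- **Notation.** Let $\mathbb N=\{1,2,\dots\}$. For non-empty finite $s,t\subset\mathbb N$ write $s<t$ if $\max s<\min t$. Let $\mathcal B^{<\omega}(\mathbb N)$ be the set of finite disjoint collections $\mathbf s=\{s_1<\dots<s_k\}$ of non-empty finite subsets of $\mathbb N$, including $\emptyset$. An infinite disjoint collection is a sequence $\mathcal D=(s_1<s_2<\cdots)$ of such sets. $FU(\cdot)$ is the set of all unions of finitely many (at least one) members of a collection; $\mathcal D_1<\mathcal D$ means $\mathcal D_1\subseteq FU(\mathcal D)$; and $\mathcal B^{<\omega}(\mathcal D)=\{\mathbf s\in\mathcal B^{<\omega}(\mathbb N):\mathbf s\subseteq FU(\mathcal D)\}$. For each non-zero countable limit ordinal $\lambda$ fix any strictly increasing sequence $(\lambda_n)_{n\ge1}$ of successor ordinals below $\lambda$ with supremum $\lambda$. Define families $\mathcal A_\xi$ $(\xi<\omega_1)$ of finite subsets of $\mathbb N$ by: $\mathcal A_0=\{\emptyset\}$; $\mathcal A_{\zeta+1}=\{\{n\}\cup s: s\in\mathcal A_\zeta,\ n<\min s \text{ if } s\neq\emptyset\}$; $\mathcal A_{\omega^{\beta+1}}=\{s_1\cup\dots\cup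 s_n: s_1<\dots<s_n \text{ in } \mathcal A_{\omega^\beta},\ n=\min s_1\}$; $\mathcal A_{\omega^\lambda}=\{s: s\in\mathcal A_{\omega^{\lambda_n}},\ n=\min s\}$ for $\lambda$ a non-zero limit; and, for a limit $\xi=\omega^{b_1}+\dots+\omega^{b_r}$ with $r\ge2$ and $b_1\ge\dots\ge b_r>0$, $\mathcal A_\xi=\{s_1\cup\dots\cup s_r: s_r<\dots<s_1,\ s_i\in\mathcal A_{\omega^{b_i}}\}$. Let $\mathcal B^\xi$ be the set of $\{s_1<\dots<s_k\}\in\mathcal B^{<\omega}(\mathbb N)$ with $\{\min s_1,\dots,\min s_k\}\in\mathcal A_\xi$ (so $\mathcal B^0=\{\emptyset\}$). For $\mathcal F\subseteq\mathcal B^{<\omega}(\mathbb N)$ let $\mathcal F^*$ be the set of initial segments of members of $\mathcal F$ together with $\emptyset$. $\mathcal F$ is *hereditary* if $\mathcal F=\mathcal F_*:=\{\mathbf t\in\mathcal B^{<\omega}(\mathbb N):\mathbf t\subseteq FU(\mathbf s)\text{ for some }\mathbf s\in\mathcal F\}\cup\{\emptyset\}$. $\mathcal F$ is *pointwise closed*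 if its set of characteristic functions is closed in $\{0,1\}^{[\mathbb N]^{<\omega}}$, where $[\mathbb N]^{<\omega}$ is the set of finite subsets of $\mathbb N$. Put $(\mathcal F)^0_{\mathcal D}=\mathcal F$; let $(\mathcal F)^1_{\mathcal D}$ be the set of $\mathbf s\in\mathcal F\cap\mathcal B^{<\omega}(\mathcal D)$ such that $\{t\in FU(\mathcal D):\mathbf s\cup\{t\}\notin\mathcal F\}$ contains no infinite disjoint collection; let $(\mathcal F)^{\zeta+1}_{\mathcal D}=((\mathcal F)^\zeta_{\mathcal D})^1_{\mathcal D}$, with intersections at limits. Let $s_{\mathcal D}(\mathcal F)$ be the least $\xi$ with $(\mathcal F)^\xi_{\mathcal D}=\emptyset$. **Theorem 3.1.** Let $\mathcal F$ be a hereditary family of finite disjoint collections and $\mathcal D$ an infinite disjoint collection. *Case 1.* If $\mathcal F\cap\mathcal B^{<\omega}(\mathcal D)$ is not pointwise closed, then there is $\mathcal D_1<\mathcal D$ with $\mathcal B^{<\omega}(\mathcal D_1)\subseteq\mathcal F$. *Case 2.* If $\mathcal F\cap\mathcal B^{<\omega}(\mathcal D)$ is pointwise closed, then for every $\mathcal D_1<\mathcal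 D$ the index $s_{\mathcal D_1}(\mathcal F)$ exists and is countable, $\xi^{\mathcal F}_{\mathcal D}:=\sup\{s_{\mathcal D_1}(\mathcal F):\mathcal D_1<\mathcal D\}$ is a countable ordinal, and for every $\xi<\omega_1$: - 2(i) if $\xi+1<\xi^{\mathcal F}_{\mathcal D}$, there is $\mathcal D_2<\mathcal D$ with $\mathcal B^\xi\cap\mathcal B^{<\omega}(\mathcal D_2)\subseteq\mathcal F$; - 2(ii) if $\xi+1>\xi^{\mathcal F}_{\mathcal D}$, then for every $\mathcal D_1<\mathcal D$ there is $\mathcal D_2<\mathcal D_1$ with $\mathcal B^\xi\cap\mathcal B^{<\omega}(\mathcal D_2)\subseteq\mathcal B^{<\omega}(\mathbb N)\setminus\mathcal F$; moreover, for every $\mathcal D_2<\mathcal D_1$ this inclusion is equivalent to $\mathcal F\cap\mathcal B^{<\omega}(\mathcal D_2)\subseteq(\mathcal B^\xi)^*\setminus\mathcal B^\xi$; - 2(iii) if $\xi+1=\xi^{\mathcal F}_{\mathcal D}$, there is $\mathcal D_2<\mathcal D$ with either $\mathcal B^\xi\cap\mathcal B^{<\omega}(\mathcal D_2)\subseteq\mathcal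 F$ or $\mathcal B^\xi\cap\mathcal B^{<\omega}(\mathcal D_2)\subseteq\mathcal B^{<\omega}(\mathbb N)\setminus\mathcal F$. Both alternatives in 2(iii) may materialize, already for $\xi=\omega$: there are $\mathcal D$ and a hereditary $\mathcal F$ with $\mathcal F\cap\mathcal B^{<\omega}(\mathcal D)$ pointwise closed and $\xi^{\mathcal F}_{\mathcal D}=\omega+1$ such that $\mathcal B^\omega\cap\mathcal B^{<\omega}(\mathcal D_2)\subseteq\mathcal F$ for every $\mathcal D_2<\mathcal D$; and there are such $\mathcal D$ and $\mathcal F$ for which $\mathcal B^\omega\cap\mathcal B^{<\omega}(\mathcal D_2)\subseteq\mathcal B^{<\omega}(\mathbb N)\setminus\mathcal F$ for every $\mathcal D_2<\mathcal D$. -/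

import Mathlib

namespace BlockRamsey

/-- `s < t` for sets of positive integers: every element of `s` lies below every element of `t`
(for non-empty finite sets this is `max s < min t`; it holds trivially if one of them is empty). -/
def BlockLT (s t : Finset ℕ+) : Prop := ∀ a ∈ s, ∀ b ∈ t, a < b

/-- A choice, for every non-zero countable limit ordinal `l`, of a strictly increasing sequence
`(lam l n)`, `n = 1, 2, …`, of successor ordinals smaller than `l` with supremum `l`. -/
def IsLadderSystem (lam : Ordinal.{0} → ℕ+ → Ordinal.{0}) : Prop :=
  ∀ l : Ordinal.{0}, Order.IsSuccLimit l → l < Ordinal.omega 1 →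
    StrictMono (lam l) ∧ (∀ n, ∃ b, lam l n = b + 1) ∧ (∀ n, lam l n < l) ∧
      IsLUB (Set.range (lam l)) l

/-- `Schreier lam ξ s` says that `s` belongs to the family `𝒜_ξ` of the recursive thin Schreier
system built from the sequences `lam`. For a choice `lam` as above, every countable ordinal is the
index of exactly one of the five rules, and that rule refers to smaller ordinals only, so this is
the recursive definition. -/
inductive Schreier (lam : Ordinal.{0} → ℕ+ → Ordinal.{0}) : Ordinal.{0} → Finset ℕ+ → Prop
  /-- `𝒜_0 = {∅}`. -/
  | zero : Schreier lam 0 ∅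
  /-- `𝒜_{ζ+1}`: the sets `{n} ∪ s` with `{n} < s` and `s ∈ 𝒜_ζ`. -/
  | succ (ζ : Ordinal.{0}) (n : ℕ+) (s : Finset ℕ+) (hn : BlockLT {n} s)
      (hs : Schreier lam ζ s) : Schreier lam (ζ + 1) (insert n s)
  /-- `𝒜_{ω^(β+1)}`: the unions of `s_1 < ⋯ < s_n` in `𝒜_{ω^β}` with `n = min s_1`. -/
  | powSucc (β : Ordinal.{0}) (n : ℕ+) (s : Fin (n : ℕ) → Finset ℕ+)
      (hmin : IsLeast (s ⟨0, n.pos⟩ : Set ℕ+) n)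
      (hlt : ∀ i j, i < j → BlockLT (s i) (s j))
      (hs : ∀ i, Schreier lam (Ordinal.omega0 ^ β) (s i)) :
      Schreier lam (Ordinal.omega0 ^ (β + 1)) (Finset.univ.biUnion s)
  /-- `𝒜_{ω^l}`, `l` a non-zero limit: the sets `s ∈ 𝒜_{ω^(l_n)}` with `n = min s`. -/
  | powLimit (l : Ordinal.{0}) (hl : Order.IsSuccLimit l) (n : ℕ+) (s : Finset ℕ+)
      (hmin : IsLeast (s : Set ℕ+) n)
      (hs : Schreier lam (Ordinal.omega0 ^ (lam l n)) s) : Schreier lam (Ordinal.omega0 ^ l) s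
  /-- The limit ordinals that are not powers of `ω`. The Cantor normal form is written out with
  repetitions instead of coefficients, as `ω^(b_0) + ⋯ + ω^(b_(r-1))` with `r ≥ 2` and
  `b_0 ≥ ⋯ ≥ b_(r-1) > 0`; the members are the unions of sets `s_(r-1) < ⋯ < s_0` with
  `s_i ∈ 𝒜_{ω^(b_i)}`. -/
  | normalForm (r : ℕ) (hr : 2 ≤ r) (b : Fin r → Ordinal.{0}) (hb : Antitone b)
      (hpos : ∀ i, 0 < b i) (s : Fin r → Finset ℕ+)
      (hlt : ∀ i j, i < j → BlockLT (s j) (s i))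
      (hs : ∀ i, Schreier lam (Ordinal.omega0 ^ (b i)) (s i)) :
      Schreier lam (List.ofFn fun i => Ordinal.omega0 ^ (b i)).sum (Finset.univ.biUnion s)

/-- All unions of finitely many (at least one) members of a collection `C` of finite sets. -/
def FU (C : Set (Finset ℕ+)) : Set (Finset ℕ+) :=
  {u | ∃ J : Finset (Finset ℕ+), J.Nonempty ∧ (∀ v ∈ J, v ∈ C) ∧ u = J.biUnion id}

/-- `ℬ^{<ω}(ℕ)`: the finite disjoint collections `s_1 < ⋯ < s_k` of non-empty finite sets of
positive integers, including the empty one. -/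
def FinColl : Set (Finset (Finset ℕ+)) :=
  {s | (∀ u ∈ s, u.Nonempty) ∧ ∀ u ∈ s, ∀ v ∈ s, u ≠ v → BlockLT u v ∨ BlockLT v u}

/-- `ℬ^ω(ℕ)`: the infinite disjoint collections, as increasing sequences of non-empty finite
sets of positive integers. -/
structure InfColl where
  seq : ℕ → Finset ℕ+
  nonempty : ∀ n, (seq n).Nonempty
  lt_succ : ∀ n, BlockLT (seq n) (seq (n + 1))

/-- The collection as a set of finite sets. -/
def InfColl.blocks (D : InfColl) : Set (Finset ℕ+) := Set.range D.seq

/-- `D₁ < D`, that is, `D₁ ⊆ FU(D)`. -/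
def InfColl.Below (D₁ D : InfColl) : Prop := D₁.blocks ⊆ FU D.blocks

/-- `ℬ^{<ω}(D)`. -/
def FinCollOf (D : InfColl) : Set (Finset (Finset ℕ+)) :=
  {s | s ∈ FinColl ∧ ∀ u ∈ s, u ∈ FU D.blocks}

/-- The minimum of a non-empty finite set of positive integers (`1` for the empty set). -/
def blockMin (u : Finset ℕ+) : ℕ+ := if h : u.Nonempty then u.min' h else 1

/-- `ℬ^ξ`: the finite disjoint collections whose set of minima lies in `𝒜_ξ`. For `ξ = 0` this is
`{∅}`; for `ξ ≥ 1` the empty collection is not a member, because `∅ ∉ 𝒜_ξ`. -/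
def BlockSchreier (lam : Ordinal.{0} → ℕ+ → Ordinal.{0}) (ξ : Ordinal.{0}) :
    Set (Finset (Finset ℕ+)) :=
  {s | s ∈ FinColl ∧ Schreier lam ξ (s.image blockMin)}

/-- `s` is an initial segment of the finite disjoint collection `t`. -/
def IsInitialSeg (s t : Finset (Finset ℕ+)) : Prop :=
  s ⊆ t ∧ ∀ u ∈ t, ∀ v ∈ s, BlockLT u v → u ∈ s

/-- `𝓕^*`: all initial segments of members of `𝓕`, and the empty collection. -/
def initialClosure (F : Set (Finset (Finset ℕ+))) : Set (Finset (Finset ℕ+)) :=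
  {t | t ∈ FinColl ∧ ∃ s ∈ F, IsInitialSeg t s} ∪ {∅}

/-- `𝓕_*`: all finite disjoint collections `t ⊆ FU(s)` with `s ∈ 𝓕`, and the empty one. -/
def lowerClosure (F : Set (Finset (Finset ℕ+))) : Set (Finset (Finset ℕ+)) :=
  {t | t ∈ FinColl ∧ ∃ s ∈ F, ∀ u ∈ t, u ∈ FU (s : Set (Finset ℕ+))} ∪ {∅}

/-- `𝓕` is hereditary. -/
def IsHereditary (F : Set (Finset (Finset ℕ+))) : Prop := lowerClosure F = F

/-- The characteristic function of a finite collection. -/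
def charFn (s : Finset (Finset ℕ+)) : Finset ℕ+ → Bool := fun u => decide (u ∈ s)

/-- `𝓕` is pointwise closed: its characteristic functions form a closed subset of the product
of copies of the discrete space `{0,1}`, one for each finite set of positive integers. -/
def PointwiseClosed (F : Set (Finset (Finset ℕ+))) : Prop := IsClosed (charFn '' F)

/-- The first strong block Cantor-Bendixson derivative of `𝓕` on `D`: those `s` in
`𝓕 ∩ ℬ^{<ω}(D)` for which `{t ∈ FU(D) : s ∪ {t} ∉ 𝓕}` contains no infinite disjoint collection. -/
def strongDeriv (D : InfColl) (F : Set (Finset (Finset ℕ+))) : Set (Finset (Finset ℕ+)) :=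
  {s | s ∈ F ∩ FinCollOf D ∧
    ¬ ∃ E : InfColl, E.blocks ⊆ {t | t ∈ FU D.blocks ∧ insert t s ∉ F}}

/-- The iterated derivatives, with intersections at limit ordinals. -/
noncomputable def iterDeriv (D : InfColl) (F : Set (Finset (Finset ℕ+))) (ξ : Ordinal.{0}) :
    Set (Finset (Finset ℕ+)) :=
  Ordinal.limitRecOn ξ F (fun _ G => strongDeriv D G) (fun ζ _ G => ⋂ β, ⋂ h : β < ζ, G β h)

/-- The strong block Cantor-Bendixson index `s_D(𝓕)`: the least `ξ` whose derivative is empty. -/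
noncomputable def strongIndex (D : InfColl) (F : Set (Finset (Finset ℕ+))) : Ordinal.{0} :=
  sInf {ξ | iterDeriv D F ξ = ∅}

/-- `ξ_D^𝓕`: the supremum of `s_{D₁}(𝓕)` over all `D₁ < D`. -/
noncomputable def supIndex (D : InfColl) (F : Set (Finset (Finset ℕ+))) : Ordinal.{0} :=
  sSup {η | ∃ D₁ : InfColl, D₁.Below D ∧ η = strongIndex D₁ F}

end BlockRamsey

/-!
The family `ℬ^ξ` is a front: every sufficiently long collection has a unique initial segment in it,
and the tree of approximations to its members has rank `ξ`. Deciding membership in `𝓕` along an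
ultrafilter that is idempotent for unions, and diagonalizing, gives `D₂ < D` on which `ℬ^ξ` is
contained in `𝓕` or disjoint from it. Comparing the rank of the front with the derivatives decides
between the two: if `ℬ^ξ` is contained in `𝓕` on `D₂`, then `∅` lies in the `ξ`-th derivative on
`D₂`, whereas if `∅` lies in the `(ξ + 1)`-st derivative, then `𝓕` meets `ℬ^ξ`.

The index is countable because a pointwise closed family has no infinite chain of end-extensions,
and ranks on the countable set of finite collections are countable ordinals.
-/

namespace BlockRamsey

open Filter Ordinal

section Collections

variable {C C' X : Set (Finset ℕ+)} {D D₁ D₂ D₃ : InfColl} {s t : Finset (Finset ℕ+)}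
  {u v w : Finset ℕ+}

/-- The block `v` lies beyond the finite collection `s`, so that adding `v` to `s` appends a last
block. -/
def Beyond (s : Finset (Finset ℕ+)) (v : Finset ℕ+) : Prop := ∀ u ∈ s, BlockLT u v

theorem BlockLT.trans (hv : v.Nonempty) (huv : BlockLT u v) (hvw : BlockLT v w) : BlockLT u w := by
  obtain ⟨b, hb⟩ := hv
  exact fun a ha c hc => (huv a ha b hb).trans (hvw b hb c hc)

theorem BlockLT.asymm (hu : u.Nonempty) (hv : v.Nonempty) (h : BlockLT u v) : ¬ BlockLT v u := by
  obtain ⟨a, ha⟩ := hu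
  obtain ⟨b, hb⟩ := hv
  exact fun h' => (h a ha b hb).asymm (h' b hb a ha)

theorem BlockLT.ne (hu : u.Nonempty) (h : BlockLT u v) : u ≠ v := by
  rintro rfl
  exact h.asymm hu hu h

theorem Beyond.notMem (hv : v.Nonempty) (h : Beyond s v) : v ∉ s := fun hvs => (h v hvs).ne hv rfl

theorem Beyond.insert (h : Beyond s v) (huv : BlockLT u v) : Beyond (insert u s) v :=
  Finset.forall_mem_insert _ _ _ |>.2 ⟨huv, h⟩

theorem blockMin_mem (hu : u.Nonempty) : blockMin u ∈ u := by
  rw [blockMin, dif_pos hu]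
  exact u.min'_mem hu

theorem blockMin_le {x : ℕ+} (hx : x ∈ u) : blockMin u ≤ x := by
  rw [blockMin, dif_pos ⟨x, hx⟩]
  exact u.min'_le x hx

theorem BlockLT.blockMin_lt (hu : u.Nonempty) (hv : v.Nonempty) (h : BlockLT u v) :
    blockMin u < blockMin v := h _ (blockMin_mem hu) _ (blockMin_mem hv)

theorem mem_FU_of_mem (hu : u ∈ C) : u ∈ FU C := ⟨{u}, by simp, by simpa using hu, by simp⟩

theorem union_mem_FU (hu : u ∈ FU C) (hv : v ∈ FU C) : u ∪ v ∈ FU C := by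
  obtain ⟨J, hJ, hJC, rfl⟩ := hu
  obtain ⟨K, -, hKC, rfl⟩ := hv
  refine ⟨J ∪ K, hJ.mono Finset.subset_union_left, fun v hv => ?_, Finset.union_biUnion.symm⟩
  exact (Finset.mem_union.1 hv).elim (hJC v) (hKC v)

theorem FU_subset_of_union_mem (hC : C ⊆ X) (hX : ∀ u ∈ X, ∀ v ∈ X, u ∪ v ∈ X) : FU C ⊆ X := by
  rintro _ ⟨J, hJ, hJC, rfl⟩
  induction hJ using Finset.Nonempty.cons_induction with
  | singleton u => simpa using hC (hJC u (by simp))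
  | cons u J _ _ ih =>
    rw [Finset.cons_eq_insert, Finset.biUnion_insert]
    exact hX _ (hC (hJC u (by simp))) _ (ih fun v hv => hJC v (by simp [hv]))

theorem FU_subset_FU (h : C ⊆ FU C') : FU C ⊆ FU C' :=
  FU_subset_of_union_mem h fun _ hu _ hv => union_mem_FU hu hv

theorem FU_mono (h : C ⊆ C') : FU C ⊆ FU C' := FU_subset_FU fun _ hu => mem_FU_of_mem (h hu)

theorem Beyond.blockLT_of_mem_FU (h : Beyond s v) (hu : u ∈ FU (s : Set (Finset ℕ+))) :
    BlockLT u v :=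
  FU_subset_of_union_mem (X := {u | BlockLT u v}) h
    (fun _ hu _ hw x hx => (Finset.mem_union.1 hx).elim (hu x) (hw x)) hu

theorem InfColl.lt (D : InfColl) {i j : ℕ} (hij : i < j) : BlockLT (D.seq i) (D.seq j) := by
  induction j, hij using Nat.le_induction with
  | base => exact D.lt_succ i
  | succ j _ ih => exact ih.trans (D.nonempty j) (D.lt_succ j)

theorem InfColl.blockLT_iff {i j : ℕ} : BlockLT (D.seq i) (D.seq j) ↔ i < j := by
  refine ⟨fun h => lt_of_not_ge fun hji => ?_, D.lt⟩
  rcases hji.eq_or_lt with rfl | hji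
  exacts [h.ne (D.nonempty j) rfl, h.asymm (D.nonempty i) (D.nonempty j) (D.lt hji)]

theorem InfColl.strictMono_blockMin (D : InfColl) : StrictMono fun n => blockMin (D.seq n) :=
  fun i j hij => (D.lt hij).blockMin_lt (D.nonempty i) (D.nonempty j)

theorem InfColl.injective_seq (D : InfColl) : D.seq.Injective :=
  .of_comp (f := blockMin) D.strictMono_blockMin.injective

theorem InfColl.nonempty_of_mem_FU (hu : u ∈ FU D.blocks) : u.Nonempty :=
  FU_subset_of_union_mem (X := {u | u.Nonempty}) (Set.range_subset_iff.2 D.nonempty)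
    (fun _ hu _ _ => hu.mono Finset.subset_union_left) hu

theorem InfColl.mem_FU_iff :
    u ∈ FU D.blocks ↔ ∃ I : Finset ℕ, I.Nonempty ∧ u = I.biUnion D.seq := by
  constructor
  · refine fun hu => FU_subset_of_union_mem
      (X := {u | ∃ I : Finset ℕ, I.Nonempty ∧ u = I.biUnion D.seq})
      (Set.range_subset_iff.2 fun n => ⟨{n}, by simp, by simp⟩) ?_ hu
    rintro _ ⟨I, hI, rfl⟩ _ ⟨J, -, rfl⟩
    exact ⟨I ∪ J, hI.mono Finset.subset_union_left, Finset.union_biUnion.symm⟩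
  · rintro ⟨I, hI, rfl⟩
    refine ⟨I.image D.seq, hI.image _, fun v hv => ?_, by rw [Finset.image_biUnion]; rfl⟩
    obtain ⟨n, -, rfl⟩ := Finset.mem_image.1 hv
    exact ⟨n, rfl⟩

theorem InfColl.Below.refl (D : InfColl) : D.Below D := fun _ hu => mem_FU_of_mem hu

theorem InfColl.Below.trans (h₁ : D₁.Below D₂) (h₂ : D₂.Below D₃) : D₁.Below D₃ :=
  fun _ hu => FU_subset_FU h₂ (h₁ hu)

theorem empty_mem_FinColl : ∅ ∈ FinColl := by simp [FinColl]

theorem empty_mem_FinCollOf (D : InfColl) : ∅ ∈ FinCollOf D := ⟨empty_mem_FinColl, by simp⟩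

theorem FinColl_subset (ht : t ∈ FinColl) (hst : s ⊆ t) : s ∈ FinColl :=
  ⟨fun u hu => ht.1 u (hst hu), fun u hu v hv => ht.2 u (hst hu) v (hst hv)⟩

theorem FinCollOf_subset (ht : t ∈ FinCollOf D) (hst : s ⊆ t) : s ∈ FinCollOf D :=
  ⟨FinColl_subset ht.1 hst, fun u hu => ht.2 u (hst hu)⟩

theorem FinCollOf_mono (h : D₁.Below D) : FinCollOf D₁ ⊆ FinCollOf D :=
  fun _ hs => ⟨hs.1, fun u hu => FU_subset_FU h (hs.2 u hu)⟩

theorem insert_mem_FinColl (hs : s ∈ FinColl) (hv : v.Nonempty) (h : Beyond s v) :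
    insert v s ∈ FinColl := by
  refine ⟨Finset.forall_mem_insert _ _ _ |>.2 ⟨hv, hs.1⟩, fun u hu w hw huw => ?_⟩
  rcases Finset.mem_insert.1 hu with rfl | hus <;> rcases Finset.mem_insert.1 hw with rfl | hws
  exacts [absurd rfl huw, Or.inr (h w hws), Or.inl (h u hus), hs.2 u hus w hws huw]

theorem insert_mem_FinCollOf (hs : s ∈ FinCollOf D) (hv : v ∈ FU D.blocks) (h : Beyond s v) :
    insert v s ∈ FinCollOf D :=
  ⟨insert_mem_FinColl hs.1 (InfColl.nonempty_of_mem_FU hv) h,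
    Finset.forall_mem_insert _ _ _ |>.2 ⟨hv, hs.2⟩⟩

theorem blockLT_of_blockMin_le (hs : s ∈ FinColl) (hu : u ∈ s) (hv : v ∈ s) (huv : u ≠ v)
    (h : blockMin u ≤ blockMin v) : BlockLT u v :=
  (hs.2 u hu v hv huv).resolve_right fun h' =>
    absurd (h'.blockMin_lt (hs.1 v hv) (hs.1 u hu)) h.not_gt

theorem exists_eq_insert_last (hs : s ∈ FinColl) (hne : s.Nonempty) :
    ∃ v t, s = insert v t ∧ v.Nonempty ∧ Beyond t v := by
  obtain ⟨v, hv, hmax⟩ := s.exists_max_image blockMin hne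
  refine ⟨v, s.erase v, (Finset.insert_erase hv).symm, hs.1 v hv, fun u hu => ?_⟩
  obtain ⟨huv, hu⟩ := Finset.mem_erase.1 hu
  exact blockLT_of_blockMin_le hs hu hv huv (hmax u hu)

theorem exists_eq_insert_first (hs : s ∈ FinColl) (hne : s.Nonempty) :
    ∃ v t, s = insert v t ∧ v.Nonempty ∧ ∀ u ∈ t, BlockLT v u := by
  obtain ⟨v, hv, hmin⟩ := s.exists_min_image blockMin hne
  refine ⟨v, s.erase v, (Finset.insert_erase hv).symm, hs.1 v hv, fun u hu => ?_⟩
  obtain ⟨huv, hu⟩ := Finset.mem_erase.1 hu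
  exact blockLT_of_blockMin_le hs hv hu huv.symm (hmin u hu)

theorem FinColl.induction {p : Finset (Finset ℕ+) → Prop} (empty : p ∅)
    (insert : ∀ v s, s ∈ FinColl → v.Nonempty → Beyond s v → p s → p (insert v s))
    (hs : s ∈ FinColl) : p s := by
  induction hn : s.card generalizing s with
  | zero => rwa [Finset.card_eq_zero.1 hn]
  | succ n ih =>
    obtain ⟨v, t, rfl, hv, hb⟩ := exists_eq_insert_last hs (Finset.card_pos.1 (by omega))
    have ht := FinColl_subset hs (Finset.subset_insert v t)
    rw [Finset.card_insert_of_notMem (hb.notMem hv)] at hn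
    exact insert v t ht hv hb (ih ht (by omega))

theorem image_range_mem_FinCollOf (D : InfColl) (n : ℕ) :
    (Finset.range n).image D.seq ∈ FinCollOf D := by
  refine ⟨⟨fun u hu => ?_, fun u hu v hv huv => ?_⟩, fun u hu => ?_⟩
  · obtain ⟨i, -, rfl⟩ := Finset.mem_image.1 hu
    exact D.nonempty i
  · obtain ⟨i, -, rfl⟩ := Finset.mem_image.1 hu
    obtain ⟨j, -, rfl⟩ := Finset.mem_image.1 hv
    exact (ne_of_apply_ne D.seq huv).lt_or_gt.imp D.lt D.lt
  · obtain ⟨i, -, rfl⟩ := Finset.mem_image.1 hu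
    exact mem_FU_of_mem ⟨i, rfl⟩

theorem InfColl.exists_mem_FU_image_range (hs : ∀ u ∈ s, u ∈ FU D.blocks) :
    ∃ n, ∀ u ∈ s, u ∈ FU ((Finset.range n).image D.seq : Set (Finset ℕ+)) := by
  suffices h : ∀ u ∈ s, ∀ᶠ n in atTop, u ∈ FU ((Finset.range n).image D.seq : Set (Finset ℕ+)) from
    ((eventually_all_finset s).2 h).exists
  intro u hu
  obtain ⟨I, hI, rfl⟩ := mem_FU_iff.1 (hs u hu)
  filter_upwards [eventually_all_finset I |>.2 fun i _ => eventually_gt_atTop i] with n hn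
  refine ⟨I.image D.seq, hI.image _, fun v hv => ?_, by rw [Finset.image_biUnion]; rfl⟩
  obtain ⟨i, hi, rfl⟩ := Finset.mem_image.1 hv
  exact Finset.mem_coe.2 (Finset.mem_image_of_mem _ (Finset.mem_range.2 (hn i hi)))

end Collections

section Far

variable {D D₁ : InfColl} {s : Finset (Finset ℕ+)} {A : Set (Finset ℕ+)}

/-- The filter of blocks tending to infinity. The empty set is not a limit point because its
`blockMin` is `1`. -/
def far : Filter (Finset ℕ+) := comap blockMin atTop

/-- The filter of blocks of `FU D` tending to infinity. -/
def InfColl.far (D : InfColl) : Filter (Finset ℕ+) := BlockRamsey.far ⊓ 𝓟 (FU D.blocks)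

instance : far.NeBot := atTop_neBot.comap_of_surj fun x => ⟨{x}, by simp [blockMin]⟩

theorem eventually_lt_blockMin (x : ℕ+) : ∀ᶠ v in far, x < blockMin v :=
  tendsto_comap.eventually (eventually_gt_atTop x)

theorem eventually_nonempty : ∀ᶠ v in far, v.Nonempty := by
  filter_upwards [eventually_lt_blockMin 1] with v hv
  rw [Finset.nonempty_iff_ne_empty]
  rintro rfl
  simp [blockMin] at hv

theorem eventually_blockLT (u : Finset ℕ+) : ∀ᶠ v in far, BlockLT u v := by
  filter_upwards [eventually_all_finset u |>.2 fun x _ => eventually_lt_blockMin x] with v hv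
  exact fun x hx y hy => (hv x hx).trans_le (blockMin_le hy)

theorem eventually_beyond (s : Finset (Finset ℕ+)) : ∀ᶠ v in far, Beyond s v :=
  eventually_all_finset s |>.2 fun u _ => eventually_blockLT u

theorem InfColl.far_le (D : InfColl) : D.far ≤ BlockRamsey.far := inf_le_left

theorem InfColl.eventually_mem_FU (D : InfColl) : ∀ᶠ v in D.far, v ∈ FU D.blocks :=
  mem_inf_of_right (mem_principal_self _)

theorem InfColl.eventually_beyond (D : InfColl) (s : Finset (Finset ℕ+)) :
    ∀ᶠ v in D.far, Beyond s v := D.far_le (BlockRamsey.eventually_beyond s)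

theorem InfColl.far_mono (h : D₁.Below D) : D₁.far ≤ D.far :=
  inf_le_inf_left _ (principal_mono.2 (FU_subset_FU h))

theorem InfColl.tendsto_seq (D : InfColl) : Tendsto D.seq atTop D.far :=
  tendsto_inf.2 ⟨tendsto_comap_iff.2 <| tendsto_atTop_atTop_of_monotone
    D.strictMono_blockMin.monotone fun x => ⟨x, (PNat.coe_le_coe _ _).1
      (StrictMono.le_apply (f := fun n => (blockMin (D.seq n) : ℕ)) D.strictMono_blockMin)⟩,
    tendsto_principal.2 (.of_forall fun n => mem_FU_of_mem ⟨n, rfl⟩)⟩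

instance (D : InfColl) : D.far.NeBot := D.tendsto_seq.neBot

theorem InfColl.eventually_far_iff {p : Finset ℕ+ → Prop} :
    (∀ᶠ v in D.far, p v) ↔ ∃ N, ∀ v ∈ FU D.blocks, N ≤ blockMin v → p v := by
  simp only [InfColl.far, BlockRamsey.far, eventually_inf_principal, eventually_comap,
    eventually_atTop]
  exact exists_congr fun N =>
    ⟨fun h v hv hN => h _ hN v rfl hv, fun h _ hN v hvN hv => h v hv (hvN ▸ hN)⟩

theorem exists_infColl (h : ∃ᶠ v in far, v ∈ A) : ∃ E : InfColl, E.blocks ⊆ A := by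
  obtain ⟨f, hf, hlt⟩ := exists_seq_of_forall_finset_exists (fun v => v ∈ A ∧ v.Nonempty) BlockLT
    fun s _ => by
      obtain ⟨v, hvA, hne, hs⟩ := (h.and_eventually
        (eventually_nonempty.and (eventually_beyond s))).exists
      exact ⟨v, ⟨hvA, hne⟩, hs⟩
  exact ⟨⟨f, fun n => (hf n).2, fun n => hlt n _ n.lt_succ_self⟩,
    Set.range_subset_iff.2 fun n => (hf n).1⟩

theorem nonempty_infColl : Nonempty InfColl :=
  (exists_infColl (A := Set.univ) (Eventually.of_forall Set.mem_univ).frequently).nonempty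

end Far

section Derivatives

variable {D D₁ : InfColl} {F : Set (Finset (Finset ℕ+))} {s t : Finset (Finset ℕ+)}
  {ξ η : Ordinal.{0}}

/-- `F` contains every finite disjoint collection of unions of members of one of its members: the
closure property of a hereditary family, without `∅ ∈ F` and `F ⊆ FinColl`, which derivatives may
lose. -/
def IsDownClosed (F : Set (Finset (Finset ℕ+))) : Prop :=
  ∀ s ∈ F, ∀ t ∈ FinColl, (∀ u ∈ t, u ∈ FU (s : Set (Finset ℕ+))) → t ∈ F

theorem IsHereditary.isDownClosed (h : IsHereditary F) : IsDownClosed F :=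
  fun s hs _ ht hts => h ▸ Or.inl ⟨ht, s, hs, hts⟩

theorem IsDownClosed.isHereditary (h : IsDownClosed F) (h₀ : ∅ ∈ F) (hF : F ⊆ FinColl) :
    IsHereditary F := by
  refine Set.Subset.antisymm ?_ fun s hs => Or.inl ⟨hF hs, s, hs, fun u hu => mem_FU_of_mem hu⟩
  rintro t (⟨ht, s, hs, hts⟩ | rfl)
  exacts [h s hs t ht hts, h₀]

theorem IsDownClosed.mem_of_subset (h : IsDownClosed F) (ht : t ∈ F) (htc : t ∈ FinColl)
    (hst : s ⊆ t) : s ∈ F :=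
  h t ht s (FinColl_subset htc hst) fun _ hu => mem_FU_of_mem (hst hu)

theorem mem_strongDeriv_iff :
    s ∈ strongDeriv D F ↔ s ∈ F ∧ s ∈ FinCollOf D ∧ ∀ᶠ v in D.far, insert v s ∈ F := by
  refine (and_assoc (b := s ∈ FinCollOf D)).trans
    (and_congr_right fun _ => and_congr_right fun _ => ⟨fun h => ?_, ?_⟩)
  · by_contra hev
    exact h (exists_infColl (frequently_inf_principal.1 (not_eventually.1 hev)))
  · rintro hev ⟨E, hE⟩
    have hED : E.far ≤ D.far := InfColl.far_mono fun v hv => (hE hv).1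
    obtain ⟨n, hn⟩ := ((E.tendsto_seq.mono_right hED).eventually hev).exists
    exact (hE ⟨n, rfl⟩).2 hn

theorem mem_iterDeriv_iff :
    s ∈ iterDeriv D F ξ ↔ s ∈ F ∧ ∀ η < ξ, s ∈ strongDeriv D (iterDeriv D F η) := by
  have iterDeriv_zero : iterDeriv D F 0 = F := Ordinal.limitRecOn_zero ..
  have iterDeriv_add_one (ζ : Ordinal.{0}) :
      iterDeriv D F (ζ + 1) = strongDeriv D (iterDeriv D F ζ) := Ordinal.limitRecOn_add_one ..
  induction ξ using Ordinal.limitRecOn with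
  | zero => simp [iterDeriv_zero]
  | add_one ζ ih =>
    rw [iterDeriv_add_one]
    refine ⟨fun hs => ⟨(ih.1 hs.1.1).1, fun η hη => ?_⟩, fun hs => hs.2 ζ (lt_add_one ζ)⟩
    rcases (Order.lt_add_one_iff.1 hη).lt_or_eq with hη | rfl
    exacts [(ih.1 hs.1.1).2 η hη, hs]
  | limit ζ hζ ih =>
    have iterDeriv_limit : iterDeriv D F ζ = ⋂ η, ⋂ _ : η < ζ, iterDeriv D F η :=
      Ordinal.limitRecOn_limit _ _ _ _ hζ
    simp only [iterDeriv_limit, Set.mem_iInter]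
    refine ⟨fun hs => ⟨iterDeriv_zero ▸ hs 0 hζ.bot_lt, fun η hη => ?_⟩, fun hs η hη => ?_⟩
    · exact iterDeriv_add_one η ▸ hs _ (hζ.add_one_lt hη)
    · exact (ih η hη).2 ⟨hs.1, fun θ hθ => hs.2 θ (hθ.trans hη)⟩

theorem iterDeriv_antitone (D : InfColl) (F : Set (Finset (Finset ℕ+))) :
    Antitone (iterDeriv D F) := by
  intro η ξ hηξ s hs
  obtain ⟨hF, h⟩ := mem_iterDeriv_iff.1 hs
  exact mem_iterDeriv_iff.2 ⟨hF, fun ζ hζ => h ζ (hζ.trans_le hηξ)⟩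

theorem eventually_insert_mem_iterDeriv (hs : s ∈ iterDeriv D F ξ) (hη : η < ξ) :
    ∀ᶠ v in D.far, insert v s ∈ iterDeriv D F η :=
  (mem_strongDeriv_iff.1 ((mem_iterDeriv_iff.1 hs).2 η hη)).2.2

theorem mem_FinCollOf_of_mem_iterDeriv (hs : s ∈ iterDeriv D F ξ) (hξ : 0 < ξ) :
    s ∈ FinCollOf D := ((mem_iterDeriv_iff.1 hs).2 0 hξ).1.2

protected theorem IsDownClosed.strongDeriv (h : IsDownClosed F) (D : InfColl) :
    IsDownClosed (strongDeriv D F) := by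
  intro s hs t ht hts
  obtain ⟨hF, hD, hins⟩ := mem_strongDeriv_iff.1 hs
  refine mem_strongDeriv_iff.2
    ⟨h s hF t ht hts, ⟨ht, fun u hu => FU_subset_FU hD.2 (hts u hu)⟩, ?_⟩
  filter_upwards [hins, D.eventually_beyond s, D.far_le eventually_nonempty] with v hv hsv hne
  refine h _ hv _ (insert_mem_FinColl ht hne fun u hu => hsv.blockLT_of_mem_FU (hts u hu)) ?_
  refine Finset.forall_mem_insert _ _ _ |>.2 ⟨mem_FU_of_mem (by simp), fun u hu => ?_⟩
  exact FU_mono (by simp) (hts u hu)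

protected theorem IsDownClosed.iterDeriv (h : IsDownClosed F) (D : InfColl) (ξ : Ordinal.{0}) :
    IsDownClosed (iterDeriv D F ξ) := by
  induction ξ using WellFoundedLT.induction with
  | ind ξ ih =>
    intro s hs t ht hts
    obtain ⟨hF, hs⟩ := mem_iterDeriv_iff.1 hs
    exact mem_iterDeriv_iff.2
      ⟨h s hF t ht hts, fun η hη => (ih η hη).strongDeriv D s (hs η hη) t ht hts⟩

theorem IsDownClosed.mem_iterDeriv (h : IsDownClosed F) (hF : s ∈ F) (hD : s ∈ FinCollOf D)
    (hins : ∀ η < ξ, ∀ᶠ v in D.far, insert v s ∈ iterDeriv D F η) : s ∈ iterDeriv D F ξ := by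
  refine mem_iterDeriv_iff.2 ⟨hF, fun η hη => mem_strongDeriv_iff.2 ⟨?_, hD, hins η hη⟩⟩
  obtain ⟨v, hv, hsv, hne⟩ := ((hins η hη).and
    ((D.eventually_beyond s).and (D.far_le eventually_nonempty))).exists
  exact (h.iterDeriv D η).mem_of_subset hv (insert_mem_FinColl hD.1 hne hsv)
    (Finset.subset_insert v s)

theorem mem_iterDeriv_of_below (hD : D₁.Below D) (hs₁ : s ∈ FinCollOf D₁)
    (hs : s ∈ iterDeriv D F ξ) : s ∈ iterDeriv D₁ F ξ := by
  induction ξ using WellFoundedLT.induction generalizing s with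
  | ind ξ ih =>
    obtain ⟨hF, hs⟩ := mem_iterDeriv_iff.1 hs
    refine mem_iterDeriv_iff.2 ⟨hF, fun η hη => ?_⟩
    obtain ⟨hη', -, hins⟩ := mem_strongDeriv_iff.1 (hs η hη)
    refine mem_strongDeriv_iff.2 ⟨ih η hη hs₁ hη', hs₁, ?_⟩
    filter_upwards [InfColl.far_mono hD hins, D₁.eventually_mem_FU, D₁.eventually_beyond s]
      with v hv hvD hsv
    exact ih η hη (insert_mem_FinCollOf hs₁ hvD hsv) hv

end Derivatives

section Diagonalization

variable {M : Type*}

/-- Whenever `p` holds along `f`, it holds for `op x y` for `f`-most `x` and `f`-most `y`. For an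
ultrafilter this says that it is idempotent under the extension of `op` to ultrafilters. -/
def StableUnder (op : M → M → M) (f : Filter M) : Prop :=
  ∀ p : M → Prop, (∀ᶠ x in f, p x) → ∀ᶠ x in f, ∀ᶠ y in f, p (op x y)

theorem StableUnder.exists_ultrafilter {op : M → M → M} [Std.Associative op] {f : Filter M}
    [f.NeBot] (hf : StableUnder op f) : ∃ U : Ultrafilter M, ↑U ≤ f ∧ StableUnder op U := by
  let : Semigroup M := { mul := op, mul_assoc := Std.Associative.assoc }
  let : Semigroup (Ultrafilter M) := Ultrafilter.semigroup
  let S : Set (Ultrafilter M) := {U | ↑U ≤ f}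
  have hS : IsClosed S := by
    have : S = ⋂ s ∈ f, {U | s ∈ U} := by
      ext U
      simp only [Set.mem_iInter]
      rfl
    exact this ▸ isClosed_biInter fun s _ => ultrafilter_isClosed_basic s
  have hmul : ∀ U ∈ S, ∀ V ∈ S, U * V ∈ S := fun U hU V hV s hs =>
    (Ultrafilter.eventually_mul U V (· ∈ s)).2
      (mem_of_superset (hU (hf (· ∈ s) hs)) fun _ hx => hV hx)
  obtain ⟨U, hU, hUU⟩ := exists_idempotent_in_compact_subsemigroup
    Ultrafilter.continuous_mul_left S (Ultrafilter.exists_le f) hS.isCompact hmul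
  exact ⟨U, hU, fun p hp => (Ultrafilter.eventually_mul U U p).1 (hUU.symm ▸ hp)⟩

theorem InfColl.stableUnder_far (D : InfColl) : StableUnder (· ∪ ·) D.far := by
  intro p hp
  obtain ⟨N, hN⟩ := InfColl.eventually_far_iff.1 hp
  refine InfColl.eventually_far_iff.2 ⟨N, fun u hu hNu => ?_⟩
  refine InfColl.eventually_far_iff.2 ⟨N, fun v hv hNv => hN _ (union_mem_FU hu hv) ?_⟩
  have hmem := blockMin_mem (InfColl.nonempty_of_mem_FU (union_mem_FU hu hv))
  rcases Finset.mem_union.1 hmem with h | h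
  exacts [hNu.trans (blockMin_le h), hNv.trans (blockMin_le h)]

theorem StableUnder.exists_seq {f : Filter (Finset ℕ+)} [f.NeBot] (hf : StableUnder (· ∪ ·) f)
    {V₀ : Set (Finset ℕ+)} (hV₀ : V₀ ∈ f) {W : Finset ℕ+ → Set (Finset ℕ+)} (hW : ∀ d, W d ∈ f) :
    ∃ d : ℕ → Finset ℕ+, ∀ I : Finset ℕ, I.Nonempty →
      I.biUnion d ∈ V₀ ∧ ∀ n, (∀ i ∈ I, n < i) → I.biUnion d ∈ W (d n) := by
  have hpick (V : {V // V ∈ f}) : ∃ d ∈ V.1, ∀ᶠ y in f, d ∪ y ∈ V.1 :=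
    ((Filter.Eventually.and V.2 (hf (· ∈ V.1) V.2)).exists)
  choose pick hpick hpick' using hpick
  let next (V : {V // V ∈ f}) : {V // V ∈ f} :=
    ⟨V.1 ∩ {y | pick V ∪ y ∈ V.1} ∩ W (pick V), inter_mem (inter_mem V.2 (hpick' V)) (hW _)⟩
  let V (n : ℕ) : {V // V ∈ f} := next^[n] ⟨V₀, hV₀⟩
  have hV (n : ℕ) : V (n + 1) = next (V n) := Function.iterate_succ_apply' ..
  have hanti : Antitone fun n => (V n).1 :=
    antitone_nat_of_succ_le fun n y hy => ((hV n ▸ hy : y ∈ (next (V n)).1)).1.1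
  have hmem (I : Finset ℕ) : I.Nonempty → ∀ n, (∀ i ∈ I, n ≤ i) →
      I.biUnion (fun n => pick (V n)) ∈ (V n).1 := by
    induction I using Finset.induction_on_min with
    | empty => simp
    | insert m I hm ih =>
      refine fun _ n hn => hanti (hn m (Finset.mem_insert_self m I)) ?_
      rcases I.eq_empty_or_nonempty with rfl | hI
      · simpa using hpick (V m)
      · rw [Finset.biUnion_insert]
        have h := ih hI (m + 1) hm
        rw [hV m] at h
        exact h.1.2
  refine ⟨fun n => pick (V n), fun I hI => ⟨hmem I hI 0 fun i _ => i.zero_le, fun n hn => ?_⟩⟩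
  have h := hmem I hI (n + 1) hn
  rw [hV n] at h
  exact h.2

theorem InfColl.exists_diagonal {D : InfColl} {f : Filter (Finset ℕ+)} [f.NeBot] (hfD : f ≤ D.far)
    (hf : StableUnder (· ∪ ·) f) {W : Finset (Finset ℕ+) → Set (Finset ℕ+)} (hW : ∀ s, W s ∈ f) :
    ∃ D₁ : InfColl, D₁.Below D ∧ ∀ s ∈ FinCollOf D₁, ∀ v ∈ FU D₁.blocks, Beyond s v → v ∈ W s := by
  -- Only finitely many collections have all their elements below an element of `d`.
  let low (d : Finset ℕ+) : Finset (Finset (Finset ℕ+)) :=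
    (d.biUnion Finset.Iic).powerset.powerset
  have hlow (d : Finset ℕ+) : {y | BlockLT d y ∧ ∀ s ∈ low d, y ∈ W s} ∈ f :=
    inter_mem (hfD.trans D.far_le (eventually_blockLT d))
      (eventually_all_finset _ |>.2 fun s _ => hW s)
  obtain ⟨d, hd⟩ := hf.exists_seq (inter_mem (hfD D.eventually_mem_FU) (hW ∅)) hlow
  have hdD (n : ℕ) : d n ∈ FU D.blocks := by simpa using (hd {n} (by simp)).1.1
  let D₁ : InfColl := ⟨d, fun n => InfColl.nonempty_of_mem_FU (hdD n), fun n => by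
    simpa using ((hd {n + 1} (by simp)).2 n (by simp)).1⟩
  refine ⟨D₁, Set.range_subset_iff.2 hdD, fun s hs v hv hsv => ?_⟩
  obtain ⟨I, hI, rfl⟩ := InfColl.mem_FU_iff.1 hv
  rcases s.eq_empty_or_nonempty with rfl | hne
  · exact (hd I hI).1.2
  obtain ⟨w, t, rfl, -, htw⟩ := exists_eq_insert_last hs.1 hne
  obtain ⟨J, hJ, rfl⟩ := InfColl.mem_FU_iff.1 (hs.2 w (Finset.mem_insert_self w t))
  obtain ⟨n, hn, hmax⟩ : ∃ n ∈ J, ∀ j ∈ J, j ≤ n := J.exists_max_image id hJ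
  have hnJ : D₁.seq n ⊆ J.biUnion D₁.seq := Finset.subset_biUnion_of_mem _ hn
  obtain ⟨y, hy⟩ := D₁.nonempty n
  have hnI : ∀ i ∈ I, n < i := fun i hi => InfColl.blockLT_iff.1 fun a ha b hb =>
    hsv _ (Finset.mem_insert_self _ t) a (hnJ ha) b (Finset.mem_biUnion.2 ⟨i, hi, hb⟩)
  refine ((hd I hI).2 n hnI).2 _ (Finset.mem_powerset.2 ?_)
  refine Finset.insert_subset (Finset.mem_powerset.2 fun x hx => ?_) fun u hu =>
    Finset.mem_powerset.2 fun x hx => Finset.mem_biUnion.2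
      ⟨y, hy, Finset.mem_Iic.2 (htw u hu x hx y (hnJ hy)).le⟩
  obtain ⟨j, hj, hx⟩ := Finset.mem_biUnion.1 hx
  rcases (hmax j hj).eq_or_lt with rfl | hjn
  · exact Finset.mem_biUnion.2 ⟨x, hx, Finset.mem_Iic.2 le_rfl⟩
  · exact Finset.mem_biUnion.2 ⟨y, hy, Finset.mem_Iic.2 (D₁.lt hjn x hx y hy).le⟩

end Diagonalization

section Fronts

variable {B F P : Set (Finset (Finset ℕ+))} {D : InfColl} {U : Filter (Finset ℕ+)}
  {α : Ordinal.{0}} {s : Finset (Finset ℕ+)}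

/-- The collection `s` has rank `α` in the tree of collections approximating members of `B`: either
`s` is a member without proper end-extensions in `B`, or its one-block end-extensions have ranks
smaller than `α` that eventually exceed every ordinal smaller than `α`. The front `B` as a whole is
ranked by `s = ∅`. -/
inductive FrontRank (B : Set (Finset (Finset ℕ+))) : Ordinal.{0} → Finset (Finset ℕ+) → Prop
  | leaf (s : Finset (Finset ℕ+)) (hs : s ∈ B)
      (hthin : ∀ c ∈ FinColl, c.Nonempty → (∀ u ∈ c, Beyond s u) → s ∪ c ∉ B) : FrontRank B 0 s
  | node (α : Ordinal.{0}) (s : Finset (Finset ℕ+)) (f : Finset ℕ+ → Ordinal.{0}) (hs : s ∉ B)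
      (hlt : ∀ v, v.Nonempty → Beyond s v → f v < α)
      (hlim : ∀ η < α, ∀ᶠ v in far, η ≤ f v)
      (hrank : ∀ v, v.Nonempty → Beyond s v → FrontRank B (f v) (insert v s)) : FrontRank B α s

/-- Adding blocks to `s` one at a time along the filter `U` leads to a first member of `B`, and this
member lies in `P`. -/
inductive Forces (U : Filter (Finset ℕ+)) (B P : Set (Finset (Finset ℕ+))) :
    Finset (Finset ℕ+) → Prop
  | leaf (s : Finset (Finset ℕ+)) (hs : s ∈ B) (hP : s ∈ P) : Forces U B P s
  | node (s : Finset (Finset ℕ+)) (W : Set (Finset ℕ+)) (hs : s ∉ B) (hW : W ∈ U)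
      (h : ∀ v ∈ W, Forces U B P (insert v s)) : Forces U B P s

theorem Forces.mem (h : Forces U B P s) (hs : s ∈ B) : s ∈ P := by
  cases h with
  | leaf _ _ hP => exact hP
  | node _ _ hs' => exact absurd hs hs'

theorem Forces.eventually_insert (h : Forces U B P s) (hs : s ∉ B) :
    ∀ᶠ v in U, Forces U B P (insert v s) := by
  cases h with
  | leaf _ hs' => exact absurd hs' hs
  | node _ W _ hW h => exact mem_of_superset hW h

theorem FrontRank.forces_or_forces_compl {U : Ultrafilter (Finset ℕ+)} (h : FrontRank B α s)
    (hU : ↑U ≤ far) (P : Set (Finset (Finset ℕ+))) : Forces U B P s ∨ Forces U B Pᶜ s := by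
  induction h with
  | leaf s hs =>
    by_cases hP : s ∈ P
    exacts [Or.inl (.leaf s hs hP), Or.inr (.leaf s hs hP)]
  | node _ s _ hs _ _ _ ih =>
    have hor : ∀ᶠ v in U, Forces U B P (insert v s) ∨ Forces U B Pᶜ (insert v s) :=
      mem_of_superset (hU (eventually_nonempty.and (eventually_beyond s)))
        fun v hv => ih v hv.1 hv.2
    rcases Ultrafilter.eventually_or.1 hor with hW | hW
    exacts [Or.inl (.node s _ hs hW fun v hv => hv), Or.inr (.node s _ hs hW fun v hv => hv)]

theorem FrontRank.union_mem_of_forces (h : FrontRank B α s)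
    (hD : ∀ s ∈ FinCollOf D, ∀ v ∈ FU D.blocks, Beyond s v →
      s ∉ B → Forces U B P s → Forces U B P (insert v s))
    (hs : s ∈ FinCollOf D) (hf : Forces U B P s) {c : Finset (Finset ℕ+)} (hc : c ∈ FinCollOf D)
    (hsc : ∀ u ∈ c, Beyond s u) (hB : s ∪ c ∈ B) : s ∪ c ∈ P := by
  induction h generalizing c with
  | leaf s _ hthin =>
    rcases c.eq_empty_or_nonempty with rfl | hne
    · exact (s.union_empty.symm ▸ hf).mem hB
    · exact absurd hB (hthin c hc.1 hne hsc)
  | node _ s _ hsB _ _ _ ih =>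
    rcases c.eq_empty_or_nonempty with rfl | hne
    · exact absurd (s.union_empty ▸ hB) hsB
    obtain ⟨v, c, rfl, hv, hvc⟩ := exists_eq_insert_first hc.1 hne
    have hvD : v ∈ FU D.blocks := hc.2 v (Finset.mem_insert_self v c)
    have hsv : Beyond s v := hsc v (Finset.mem_insert_self v c)
    rw [Finset.union_insert, ← Finset.insert_union] at hB ⊢
    exact ih v hv hsv (insert_mem_FinCollOf hs hvD hsv) (hD s hs v hvD hsv hsB hf)
      (FinCollOf_subset hc (Finset.subset_insert v c))
      (fun u hu => (hsc u (Finset.mem_insert_of_mem hu)).insert (hvc u hu)) hB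

theorem FrontRank.exists_subset_of_forces [U.NeBot] (h : FrontRank B α ∅) (hUD : U ≤ D.far)
    (hU : StableUnder (· ∪ ·) U) (hf : Forces U B P ∅) :
    ∃ D₁ : InfColl, D₁.Below D ∧ B ∩ FinCollOf D₁ ⊆ P := by
  obtain ⟨D₁, hD₁, hdiag⟩ := InfColl.exists_diagonal hUD hU
    (W := fun s => {v | s ∉ B → Forces U B P s → Forces U B P (insert v s)}) fun s => by
      by_cases hs : s ∉ B ∧ Forces U B P s
      · exact mem_of_superset (hs.2.eventually_insert hs.1) fun v hv _ _ => hv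
      · exact univ_mem' fun v hsB hsf => absurd ⟨hsB, hsf⟩ hs
  refine ⟨D₁, hD₁, fun s hs => ?_⟩
  have := h.union_mem_of_forces hdiag (empty_mem_FinCollOf D₁) hf hs.2 (fun u _ => by simp [Beyond])
  simpa using this (by simpa using hs.1)

theorem FrontRank.exists_homogeneous (h : FrontRank B α ∅) (P : Set (Finset (Finset ℕ+)))
    (D : InfColl) :
    ∃ D₁ : InfColl, D₁.Below D ∧
      (B ∩ FinCollOf D₁ ⊆ P ∨ B ∩ FinCollOf D₁ ⊆ FinColl \ P) := by
  obtain ⟨U, hUD, hU⟩ := D.stableUnder_far.exists_ultrafilter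
  rcases h.forces_or_forces_compl (hUD.trans D.far_le) P with hf | hf
  · obtain ⟨D₁, hD₁, hP⟩ := h.exists_subset_of_forces hUD hU hf
    exact ⟨D₁, hD₁, Or.inl hP⟩
  · obtain ⟨D₁, hD₁, hP⟩ := h.exists_subset_of_forces hUD hU hf
    exact ⟨D₁, hD₁, Or.inr fun s hs => ⟨hs.2.1, hP hs⟩⟩

theorem FrontRank.exists_mem_of_mem_iterDeriv (h : FrontRank B α s)
    (hs : s ∈ iterDeriv D F (α + 1)) : ∃ b ∈ B ∩ FinCollOf D, b ∈ F := by
  induction h with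
  | leaf s hsB =>
    exact ⟨s, ⟨hsB, mem_FinCollOf_of_mem_iterDeriv hs (by simp)⟩, (mem_iterDeriv_iff.1 hs).1⟩
  | node α s f _ hlt _ _ ih =>
    obtain ⟨v, hv, hsv, hne⟩ := ((eventually_insert_mem_iterDeriv hs (lt_add_one α)).and
      ((D.eventually_beyond s).and (D.far_le eventually_nonempty))).exists
    exact ih v hne hsv (iterDeriv_antitone D F (Order.add_one_le_of_lt (hlt v hne hsv)) hv)

theorem FrontRank.mem_iterDeriv (h : FrontRank B α s) (hF : IsDownClosed F)
    (hs : s ∈ FinCollOf D) (hB : ∀ b ∈ B ∩ FinCollOf D, s ⊆ b → b ∈ F) :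
    s ∈ iterDeriv D F α := by
  induction h with
  | leaf s hsB =>
    exact mem_iterDeriv_iff.2 ⟨hB s ⟨hsB, hs⟩ subset_rfl, fun η hη => absurd hη (by simp)⟩
  | node α s f _ _ hlim _ ih =>
    have hmem : ∀ v ∈ FU D.blocks, Beyond s v → insert v s ∈ iterDeriv D F (f v) :=
      fun v hv hsv => ih v (InfColl.nonempty_of_mem_FU hv) hsv (insert_mem_FinCollOf hs hv hsv)
        fun b hb hsb => hB b hb ((Finset.subset_insert v s).trans hsb)
    have hsF : s ∈ F := by
      obtain ⟨v, hv, hsv⟩ := (D.eventually_mem_FU.and (D.eventually_beyond s)).exists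
      exact hF.mem_of_subset (mem_iterDeriv_iff.1 (hmem v hv hsv)).1
        (insert_mem_FinCollOf hs hv hsv).1 (Finset.subset_insert v s)
    refine hF.mem_iterDeriv hsF hs fun η hη => ?_
    filter_upwards [D.far_le (hlim η hη), D.eventually_mem_FU, D.eventually_beyond s]
      with v hηv hv hsv
    exact iterDeriv_antitone D F hηv (hmem v hv hsv)

theorem FrontRank.exists_union_mem (h : FrontRank B α s) :
    ∃ c : Finset (Finset ℕ+), (∀ u ∈ c, u.Nonempty ∧ Beyond s u) ∧ s ∪ c ∈ B := by
  induction h with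
  | leaf s hs => exact ⟨∅, by simp, by simpa using hs⟩
  | node _ s _ _ _ _ _ ih =>
    obtain ⟨v, hv, hsv⟩ := (eventually_nonempty.and (eventually_beyond s)).exists
    obtain ⟨c, hc, hB⟩ := ih v hv hsv
    refine ⟨insert v c, Finset.forall_mem_insert _ _ _ |>.2 ⟨⟨hv, hsv⟩, fun u hu => ?_⟩, ?_⟩
    · exact ⟨(hc u hu).1, fun w hw => (hc u hu).2 w (Finset.mem_insert_of_mem hw)⟩
    · rwa [Finset.union_insert, ← Finset.insert_union]

theorem isInitialSeg_union {c : Finset (Finset ℕ+)} (hs : s ∈ FinColl)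
    (hc : ∀ u ∈ c, u.Nonempty ∧ Beyond s u) : IsInitialSeg s (s ∪ c) := by
  refine ⟨Finset.subset_union_left, fun u hu v hv huv => ?_⟩
  refine (Finset.mem_union.1 hu).elim id fun hu => absurd huv ?_
  exact ((hc u hu).2 v hv).asymm (hs.1 v hv) (hc u hu).1

theorem FrontRank.exists_subset_or_exists_frontRank (h : FrontRank B α ∅) (hs : s ∈ FinColl) :
    (∃ b ∈ B, b ⊆ s) ∨ ∃ β, FrontRank B β s := by
  refine FinColl.induction (p := fun s => (∃ b ∈ B, b ⊆ s) ∨ ∃ β, FrontRank B β s)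
    (Or.inr ⟨α, h⟩) (fun v s _ hv hsv ih => ?_) hs
  rcases ih with ⟨b, hb, hbs⟩ | ⟨β, hβ⟩
  · exact Or.inl ⟨b, hb, hbs.trans (Finset.subset_insert v s)⟩
  · cases hβ with
    | leaf _ hsB => exact Or.inl ⟨s, hsB, Finset.subset_insert v s⟩
    | node _ _ f _ _ _ hr => exact Or.inr ⟨_, hr v hv hsv⟩

theorem FrontRank.subset_sdiff_iff (h : FrontRank B α ∅) (hF : IsDownClosed F) (D : InfColl) :
    B ∩ FinCollOf D ⊆ FinColl \ F ↔ F ∩ FinCollOf D ⊆ initialClosure B \ B := by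
  refine ⟨fun hB s ⟨hsF, hsD⟩ => ?_, fun hB s ⟨hsB, hsD⟩ =>
    ⟨hsD.1, fun hsF => (hB ⟨hsF, hsD⟩).2 hsB⟩⟩
  have hsB : ∀ b ∈ B, ¬ b ⊆ s := fun b hb hbs =>
    (hB ⟨hb, FinCollOf_subset hsD hbs⟩).2 (hF.mem_of_subset hsF hsD.1 hbs)
  refine ⟨?_, fun hs => hsB s hs subset_rfl⟩
  rcases h.exists_subset_or_exists_frontRank hsD.1 with ⟨b, hb, hbs⟩ | ⟨β, hβ⟩
  · exact absurd hbs (hsB b hb)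
  · obtain ⟨c, hc, hscB⟩ := hβ.exists_union_mem
    exact Or.inl ⟨hsD.1, _, hscB, isInitialSeg_union hsD.1 hc⟩

end Fronts

section PointwiseClosed

variable {D D₁ : InfColl} {F : Set (Finset (Finset ℕ+))} {G : Set (Finset ℕ+)}

theorem exists_agree_of_mem_closure {g : Finset ℕ+ → Bool} (hg : g ∈ closure (charFn '' F))
    (C : Finset (Finset ℕ+)) : ∃ s ∈ F, ∀ u ∈ C, charFn s u = g u := by
  have hnear : ∀ᶠ h in nhds g, ∀ u ∈ C, h u = g u :=
    eventually_all_finset C |>.2 fun u _ =>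
      (tendsto_pi_nhds.1 tendsto_id u).eventually (isOpen_discrete {g u} |>.mem_nhds rfl)
  obtain ⟨_, ⟨s, hs, rfl⟩, h⟩ := ((mem_closure_iff_frequently.1 hg).and_eventually hnear).exists
  exact ⟨s, hs, h⟩

theorem exists_infColl_of_infinite
    (hG : ∀ C : Finset (Finset ℕ+), (C : Set (Finset ℕ+)) ⊆ G → C ∈ FinColl) (hinf : G.Infinite) :
    ∃ E : InfColl, E.blocks ⊆ G := by
  refine exists_infColl fun hfar => hinf ?_
  obtain ⟨N, -, hN⟩ := (atTop_basis.comap blockMin).eventually_iff.1 hfar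
  refine Set.Finite.of_injOn (f := blockMin) (t := Set.Iio N)
    (fun v hv => Set.mem_Iio.2 <| not_le.1 fun hle => hN hle hv) (fun u hu v hv huv => ?_)
    (Set.finite_Iio N)
  by_contra hne
  have hC : {u, v} ∈ FinColl := hG {u, v} (by simp [Set.insert_subset_iff, hu, hv])
  have huv' := blockLT_of_blockMin_le hC (by simp) (by simp) hne huv.le
  exact (huv'.blockMin_lt (hC.1 u (by simp)) (hC.1 v (by simp))).ne huv

theorem IsDownClosed.exists_FinCollOf_subset (hF : IsDownClosed F)
    (h : ¬ PointwiseClosed (F ∩ FinCollOf D)) :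
    ∃ D₁ : InfColl, D₁.Below D ∧ FinCollOf D₁ ⊆ F := by
  rw [PointwiseClosed, ← closure_subset_iff_isClosed, Set.not_subset] at h
  obtain ⟨g, hg, hgF⟩ := h
  have hfin (C : Finset (Finset ℕ+)) (hC : ∀ u ∈ C, g u = true) : C ∈ F ∩ FinCollOf D := by
    obtain ⟨s, ⟨hsF, hsD⟩, hs⟩ := exists_agree_of_mem_closure hg C
    have hCs : C ⊆ s := fun u hu => by simpa [charFn] using (hs u hu).trans (hC u hu)
    exact ⟨hF.mem_of_subset hsF hsD.1 hCs, FinCollOf_subset hsD hCs⟩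
  have hinf : {u | g u = true}.Infinite := fun hG => by
    refine hgF ⟨hG.toFinset, hfin _ (by simp), funext fun u => ?_⟩
    simp [charFn]
  obtain ⟨E, hE⟩ := exists_infColl_of_infinite (fun C hC => (hfin C hC).2.1) hinf
  replace hE : ∀ u ∈ E.blocks, g u = true := hE
  refine ⟨E, fun u hu => (hfin {u} (by simpa using hE u hu)).2.2 u (by simp), fun s hs => ?_⟩
  obtain ⟨n, hn⟩ := InfColl.exists_mem_FU_image_range hs.2
  refine hF _ (hfin _ fun u hu => ?_).1 s hs.1 hn
  obtain ⟨i, -, rfl⟩ := Finset.mem_image.1 hu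
  exact hE _ ⟨i, rfl⟩

theorem PointwiseClosed.not_FinCollOf_subset (h : PointwiseClosed (F ∩ FinCollOf D))
    (hD : D₁.Below D) : ¬ FinCollOf D₁ ⊆ F := by
  classical
  intro hF
  have hlim : Tendsto (fun n => charFn ((Finset.range n).image D₁.seq)) atTop
      (nhds fun u => decide (u ∈ D₁.blocks)) := by
    refine tendsto_pi_nhds.2 fun u => tendsto_nhds_of_eventually_eq ?_
    by_cases hu : u ∈ D₁.blocks
    · obtain ⟨i, rfl⟩ := hu
      filter_upwards [eventually_gt_atTop i] with n hn
      simpa [charFn, InfColl.blocks] using ⟨i, hn, rfl⟩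
    · refine .of_forall fun n => ?_
      simpa [charFn, hu] using fun i _ hi => hu ⟨i, hi⟩
  obtain ⟨s, -, hs⟩ := h.mem_of_tendsto hlim (.of_forall fun n =>
    ⟨_, ⟨hF (image_range_mem_FinCollOf D₁ n),
      FinCollOf_mono hD (image_range_mem_FinCollOf D₁ n)⟩, rfl⟩)
  refine Set.infinite_range_of_injective D₁.injective_seq (s.finite_toSet.subset fun u hu => ?_)
  simpa [charFn, InfColl.blocks, Set.mem_range.1 hu] using congrFun hs u

end PointwiseClosed

section Index

variable {D D₁ : InfColl} {F B : Set (Finset (Finset ℕ+))} {s : Finset (Finset ℕ+)}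
  {α ξ : Ordinal.{0}}

theorem rank_lt_omega_one {X : Type} [Countable X] (r : X → X → Prop) [IsWellFounded X r] (a : X) :
    IsWellFounded.rank r a < ω₁ := by
  induction a using IsWellFounded.induction r with
  | ind a ih =>
    rw [IsWellFounded.rank_eq]
    exact Ordinal.iSup_lt_omega_one fun b => (Cardinal.isSuccLimit_omega 1).succ_lt (ih b b.2)

/-- `EndExtension D F t s`: the collection `t` is a member of `F` that end-extends `s` by one block
of `FU D`. The rank of `∅` bounds the strong Cantor-Bendixson indices of `F` on all `D₁ < D`. -/
def EndExtension (D : InfColl) (F : Set (Finset (Finset ℕ+))) (t s : Finset (Finset ℕ+)) : Prop :=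
  ∃ v ∈ FU D.blocks, Beyond s v ∧ t = insert v s ∧ t ∈ F

theorem PointwiseClosed.wellFounded_endExtension (hF : IsDownClosed F)
    (h : PointwiseClosed (F ∩ FinCollOf D)) : WellFounded (EndExtension D F) := by
  rw [wellFounded_iff_isEmpty_descending_chain]
  refine ⟨fun ⟨f, hf⟩ => ?_⟩
  choose v hvD hv hfv hfF using hf
  let E : InfColl := ⟨v, fun n => InfColl.nonempty_of_mem_FU (hvD n), fun n =>
    hv (n + 1) _ (hfv n ▸ Finset.mem_insert_self ..)⟩
  have hE (n : ℕ) : (Finset.range n).image E.seq ⊆ f n := by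
    induction n with
    | zero => simp
    | succ n ih =>
      rw [hfv, Finset.range_add_one, Finset.image_insert]
      exact Finset.insert_subset_insert _ ih
  refine h.not_FinCollOf_subset (D₁ := E) (by rintro _ ⟨n, rfl⟩; exact hvD n) fun s hs => ?_
  obtain ⟨n, hn⟩ := InfColl.exists_mem_FU_image_range hs.2
  refine hF _ (hfF n) s hs.1 fun u hu => FU_mono (Finset.coe_subset.2 ?_) (hn u hu)
  exact (hE n).trans (hfv n ▸ Finset.subset_insert _ _)

theorem le_rank_of_mem_iterDeriv [IsWellFounded _ (EndExtension D F)] (hD : D₁.Below D)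
    (hs : s ∈ iterDeriv D₁ F ξ) : ξ ≤ IsWellFounded.rank (EndExtension D F) s := by
  induction s using IsWellFounded.induction (EndExtension D F) generalizing ξ with
  | ind s ih =>
    refine le_of_forall_lt fun η hη => ?_
    obtain ⟨v, hvη, hv, hsv⟩ := ((eventually_insert_mem_iterDeriv hs hη).and
      (D₁.eventually_mem_FU.and (D₁.eventually_beyond s))).exists
    have hvs : EndExtension D F (insert v s) s :=
      ⟨v, FU_subset_FU hD hv, hsv, rfl, (mem_iterDeriv_iff.1 hvη).1⟩
    exact (ih _ hvs hvη).trans_lt (IsWellFounded.rank_lt_of_rel hvs)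

theorem IsDownClosed.empty_mem_iterDeriv_iff (hF : IsDownClosed F) :
    ∅ ∈ iterDeriv D F ξ ↔ iterDeriv D F ξ ≠ ∅ := by
  refine ⟨fun h => Set.nonempty_iff_ne_empty.1 ⟨_, h⟩, fun h => ?_⟩
  obtain ⟨s, hs⟩ := Set.nonempty_iff_ne_empty.2 h
  exact hF.iterDeriv D ξ s hs ∅ empty_mem_FinColl (by simp)

theorem PointwiseClosed.exists_iterDeriv_eq_empty (hF : IsDownClosed F)
    (h : PointwiseClosed (F ∩ FinCollOf D)) :
    ∃ α < ω₁, ∀ D₁ : InfColl, D₁.Below D → iterDeriv D₁ F α = ∅ := by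
  have : IsWellFounded _ (EndExtension D F) := ⟨h.wellFounded_endExtension hF⟩
  refine ⟨IsWellFounded.rank (EndExtension D F) ∅ + 1,
    (Cardinal.isSuccLimit_omega 1).add_one_lt (rank_lt_omega_one _ _), fun D₁ hD => ?_⟩
  by_contra hne
  exact (lt_add_one _).not_ge
    (le_rank_of_mem_iterDeriv hD (hF.empty_mem_iterDeriv_iff.2 hne))

theorem lt_strongIndex_iff (hF : IsDownClosed F) (h : ∃ α, iterDeriv D F α = ∅) :
    ξ < strongIndex D F ↔ ∅ ∈ iterDeriv D F ξ := by
  rw [hF.empty_mem_iterDeriv_iff]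
  refine ⟨notMem_of_lt_csInf' (s := {ξ | iterDeriv D F ξ = ∅}),
    fun hξ => lt_of_not_ge fun hle => hξ ?_⟩
  exact Set.subset_eq_empty (iterDeriv_antitone D F hle) (csInf_mem h)

variable (hα : ∀ D₁ : InfColl, D₁.Below D → iterDeriv D₁ F α = ∅)
include hα

theorem supIndex_le : supIndex D F ≤ α :=
  csSup_le' (by rintro _ ⟨D₁, hD₁, rfl⟩; exact csInf_le' (hα D₁ hD₁))

theorem lt_supIndex_iff (hF : IsDownClosed F) :
    ξ < supIndex D F ↔ ∃ D₁ : InfColl, D₁.Below D ∧ ∅ ∈ iterDeriv D₁ F ξ := by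
  rw [supIndex, lt_csSup_iff]
  · constructor
    · rintro ⟨_, ⟨D₁, hD₁, rfl⟩, hξ⟩
      exact ⟨D₁, hD₁, (lt_strongIndex_iff hF ⟨α, hα D₁ hD₁⟩).1 hξ⟩
    · rintro ⟨D₁, hD₁, hξ⟩
      exact ⟨_, ⟨D₁, hD₁, rfl⟩, (lt_strongIndex_iff hF ⟨α, hα D₁ hD₁⟩).2 hξ⟩
  · exact ⟨α, by rintro _ ⟨D₁, hD₁, rfl⟩; exact csInf_le' (hα D₁ hD₁)⟩
  · exact ⟨_, D, InfColl.Below.refl D, rfl⟩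

theorem FrontRank.exists_subset_of_lt_supIndex (hB : FrontRank B ξ ∅) (hF : IsDownClosed F)
    (hξ : ξ + 1 < supIndex D F) : ∃ D₂ : InfColl, D₂.Below D ∧ B ∩ FinCollOf D₂ ⊆ F := by
  obtain ⟨D₁, hD₁, hmem⟩ := (lt_supIndex_iff hα hF).1 hξ
  obtain ⟨D₂, hD₂, h | h⟩ := hB.exists_homogeneous F D₁
  · exact ⟨D₂, hD₂.trans hD₁, h⟩
  · obtain ⟨b, hb, hbF⟩ := hB.exists_mem_of_mem_iterDeriv
      (mem_iterDeriv_of_below hD₂ (empty_mem_FinCollOf D₂) hmem)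
    exact absurd hbF (h hb).2

theorem FrontRank.exists_subset_sdiff_of_supIndex_lt (hB : FrontRank B ξ ∅) (hF : IsDownClosed F)
    (hξ : supIndex D F < ξ + 1) (hD₁ : D₁.Below D) :
    ∃ D₂ : InfColl, D₂.Below D₁ ∧ B ∩ FinCollOf D₂ ⊆ FinColl \ F := by
  obtain ⟨D₂, hD₂, h | h⟩ := hB.exists_homogeneous F D₁
  · have hmem : ∅ ∈ iterDeriv D₂ F ξ :=
      hB.mem_iterDeriv hF (empty_mem_FinCollOf D₂) fun b hb _ => h hb
    exact absurd (Order.lt_add_one_iff.1 hξ)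
      ((lt_supIndex_iff hα hF).2 ⟨D₂, hD₂.trans hD₁, hmem⟩).not_ge
  · exact ⟨D₂, hD₂, h⟩

end Index

section SumPow

variable {l l' : List Ordinal.{0}} {b e : Ordinal.{0}}

/-- The ordinal `ω ^ b₀ + ⋯ + ω ^ bₖ` with the list of exponents `b₀, …, bₖ`. For a non-increasing
list this is the Cantor normal form, written with repetitions instead of coefficients. -/
noncomputable def sumPow (l : List Ordinal.{0}) : Ordinal.{0} := (l.map (ω ^ ·)).sum

theorem sumPow_cons (b : Ordinal.{0}) (l : List Ordinal.{0}) :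
    sumPow (b :: l) = ω ^ b + sumPow l := by
  simp [sumPow]

theorem sumPow_lt (h : ∀ b ∈ l, b < e) : sumPow l < ω ^ e := by
  induction l with
  | nil => exact opow_pos e omega0_pos
  | cons b l ih =>
    rw [List.forall_mem_cons] at h
    rw [sumPow_cons]
    exact isPrincipal_add_omega0_opow e ((opow_lt_opow_iff_right one_lt_omega0).2 h.1) (ih h.2)

theorem opow_le_sumPow (h : b ∈ l) : ω ^ b ≤ sumPow l :=
  List.le_sum_of_mem (List.mem_map_of_mem h)

theorem sumPow_cons_ne_zero (b : Ordinal.{0}) (l : List Ordinal.{0}) : sumPow (b :: l) ≠ 0 := by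
  simp [sumPow_cons]

theorem log_sumPow_cons (h : (b :: l).Pairwise (· ≥ ·)) : log ω (sumPow (b :: l)) = b := by
  refine le_antisymm ?_ (le_log_of_opow_le one_lt_omega0 (opow_le_sumPow List.mem_cons_self))
  rw [← Order.lt_add_one_iff, ← lt_opow_iff_log_lt one_lt_omega0 (sumPow_cons_ne_zero b l)]
  exact sumPow_lt fun c hc => Order.lt_add_one_iff.2 <|
    (List.mem_cons.1 hc).elim le_of_eq (List.rel_of_pairwise_cons h)

theorem sumPow_injective (hl : l.Pairwise (· ≥ ·)) (hl' : l'.Pairwise (· ≥ ·))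
    (h : sumPow l = sumPow l') : l = l' := by
  induction l generalizing l' with
  | nil => cases l' with
    | nil => rfl
    | cons b l' => exact absurd h.symm (sumPow_cons_ne_zero b l')
  | cons a l ih => cases l' with
    | nil => exact absurd h (sumPow_cons_ne_zero a l)
    | cons b l' =>
      obtain rfl : a = b := by rw [← log_sumPow_cons hl, h, log_sumPow_cons hl']
      rw [sumPow_cons, sumPow_cons, add_right_inj] at h
      rw [ih hl.of_cons hl'.of_cons h]

theorem exists_sumPow (ξ : Ordinal.{0}) : ∃ l : List Ordinal.{0}, l.Pairwise (· ≥ ·) ∧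
    sumPow l = ξ := by
  induction ξ using WellFoundedLT.induction with
  | ind ξ ih =>
    rcases eq_or_ne ξ 0 with rfl | hξ
    · exact ⟨[], List.Pairwise.nil, rfl⟩
    · obtain ⟨l, hl, hsum⟩ := ih _ (sub_omega0_opow_log_lt hξ)
      refine ⟨log ω ξ :: l, List.pairwise_cons.2 ⟨fun c hc => ?_, hl⟩, ?_⟩
      · exact le_log_of_opow_le one_lt_omega0
          ((opow_le_sumPow hc).trans (hsum ▸ sub_le_self _ _))
      · rw [sumPow_cons, hsum, Ordinal.add_sub_cancel_of_le (opow_log_le_self _ hξ)]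

theorem isSuccLimit_omega0_opow (hb : b ≠ 0) : Order.IsSuccLimit (ω ^ b) :=
  isSuccLimit_opow_left isSuccLimit_omega0 hb

theorem isSuccLimit_sumPow_iff (hl : l.Pairwise (· ≥ ·)) :
    Order.IsSuccLimit (sumPow l) ↔ l ≠ [] ∧ ∀ b ∈ l, b ≠ 0 := by
  induction l with
  | nil => simp [sumPow]
  | cons b l ih =>
    have hpow : Order.IsSuccLimit (ω ^ b) ↔ b ≠ 0 := by
      refine ⟨?_, isSuccLimit_omega0_opow⟩
      rintro h rfl
      exact Order.not_isSuccLimit_add_one (0 : Ordinal.{0}) (by rwa [opow_zero, ← zero_add 1] at h)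
    rw [sumPow_cons, isSuccLimit_add_iff, ih hl.of_cons, hpow]
    cases l with
    | nil => simp [sumPow]
    | cons c l =>
      have hc : c ≠ 0 → b ≠ 0 := fun hc hb =>
        hc (nonpos_iff_eq_zero.1 (hb ▸ List.rel_of_pairwise_cons hl List.mem_cons_self))
      simp only [sumPow_cons_ne_zero, List.forall_mem_cons]
      tauto

end SumPow

section Uniform

variable {A B C : Set (Finset ℕ+)} {α γ : Ordinal.{0}} {m m' : ℕ} {n : ℕ+} {s u : Finset ℕ+}

/-- The sets which become members of `A` by adding `n`. Only sets with all elements greater than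
`n` are of interest. -/
def tail (A : Set (Finset ℕ+)) (n : ℕ+) : Set (Finset ℕ+) := {s | insert n s ∈ A}

/-- The unions of a member of `C` with a later member of `A`. -/
def join (C A : Set (Finset ℕ+)) : Set (Finset ℕ+) :=
  {u | ∃ c ∈ C, ∃ a ∈ A, BlockLT c a ∧ u = c ∪ a}

/-- The iterated join of a list of families. The *last* entry of the list contributes the
*smallest* elements, as in the Cantor normal form rule for `𝒜_ξ`. -/
def chain : List (Set (Finset ℕ+)) → Set (Finset ℕ+)
  | [] => {∅}
  | A :: l => join (chain l) A

/-- The family `A`, considered only on the integers greater than `m`, is uniform of rank `α`: it is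
`{∅}` if `α = 0`, and otherwise its tails are uniform with ranks that are smaller than `α` and
eventually exceed every ordinal smaller than `α`. -/
inductive Uniform : Ordinal.{0} → ℕ → Set (Finset ℕ+) → Prop
  | zero (m : ℕ) (A : Set (Finset ℕ+)) (hA : ∀ s : Finset ℕ+, (∀ x ∈ s, m < x) → (s ∈ A ↔ s = ∅)) :
      Uniform 0 m A
  | step (α : Ordinal.{0}) (m : ℕ) (A : Set (Finset ℕ+)) (f : ℕ+ → Ordinal.{0}) (hA : ∅ ∉ A)
      (hlt : ∀ n : ℕ+, m < n → f n < α) (hlim : ∀ η < α, ∀ᶠ n in atTop, η ≤ f n)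
      (htail : ∀ n : ℕ+, m < n → Uniform (f n) n (tail A n)) : Uniform α m A

theorem isLeast_insert (hs : ∀ x ∈ s, n < x) : IsLeast (insert n s : Finset ℕ+) n :=
  ⟨Finset.mem_insert_self n s,
    Finset.forall_mem_insert _ _ _ |>.2 ⟨le_rfl, fun x hx => (hs x hx).le⟩⟩

theorem Uniform.mono (h : Uniform α m A) (hm : m ≤ m') : Uniform α m' A := by
  cases h with
  | zero _ _ hA => exact .zero m' A fun s hs => hA s fun x hx => hm.trans_lt (hs x hx)
  | step _ _ _ f hA hlt hlim htail =>
    exact .step α m' A f hA (fun n hn => hlt n (hm.trans_lt hn)) hlim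
      fun n hn => htail n (hm.trans_lt hn)

theorem Uniform.congr (h : Uniform α m A)
    (hAB : ∀ s : Finset ℕ+, (∀ x ∈ s, m < x) → (s ∈ A ↔ s ∈ B)) : Uniform α m B := by
  induction h generalizing B with
  | zero m A hA => exact .zero m B fun s hs => (hAB s hs).symm.trans (hA s hs)
  | step α m A f hA hlt hlim _ ih =>
    refine .step α m B f (fun h => hA ((hAB ∅ (by simp)).2 h)) hlt hlim fun n hn => ?_
    refine ih n hn fun s hs => hAB _ ?_
    exact Finset.forall_mem_insert _ _ _ |>.2 ⟨hn, fun x hx => hn.trans (hs x hx)⟩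

theorem Uniform.empty_notMem (h : Uniform α m A) (hα : α ≠ 0) : ∅ ∉ A := by
  cases h with
  | zero => exact absurd rfl hα
  | step _ _ _ _ hA => exact hA

theorem Uniform.of_isLeast {f : ℕ+ → Ordinal.{0}} {C : ℕ+ → Set (Finset ℕ+)}
    (hA : ∀ u, u ∈ A ↔ ∃ n, IsLeast (u : Set ℕ+) n ∧ u ∈ C n) (hlt : ∀ n, f n < α)
    (hlim : ∀ η < α, ∀ᶠ n in atTop, η ≤ f n) (hC : ∀ n, Uniform (f n) n (tail (C n) n)) :
    Uniform α m A := by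
  refine .step α m A f (fun h => ?_) (fun n _ => hlt n) hlim
    fun n _ => (hC n).congr fun s hs => ?_
  · obtain ⟨n, hn, -⟩ := (hA ∅).1 h
    exact absurd hn.1 (by simp)
  · have hleast := isLeast_insert hs
    exact ((hA _).trans ⟨fun ⟨k, hk, hu⟩ => hleast.unique hk ▸ hu, fun hu => ⟨n, hleast, hu⟩⟩).symm

theorem mem_tail_join (hC : ∅ ∉ C) (hu : ∀ x ∈ u, n < x) :
    u ∈ tail (join C A) n ↔ u ∈ join (tail C n) A := by
  constructor
  · rintro ⟨c, hc, a, ha, hca, hcau⟩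
    have hle : ∀ x ∈ c ∪ a, n ≤ x := fun x hx => (isLeast_insert hu).2 (hcau ▸ hx)
    have hna : n ∉ a := fun hna => by
      obtain ⟨y, hy⟩ := Finset.nonempty_iff_ne_empty.2 (ne_of_mem_of_not_mem hc hC)
      exact (hca y hy n hna).not_ge (hle y (Finset.mem_union_left a hy))
    have hnc : n ∈ c := (Finset.mem_union.1 (hcau ▸ Finset.mem_insert_self n u)).resolve_right hna
    refine ⟨c.erase n, ?_, a, ha, fun x hx => hca x (Finset.mem_of_mem_erase hx), ?_⟩
    · rwa [tail, Set.mem_ofPred_eq, Finset.insert_erase hnc]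
    · rw [← Finset.erase_eq_of_notMem hna, ← Finset.erase_union_distrib, ← hcau,
        Finset.erase_insert fun h => lt_irrefl n (hu n h)]
  · rintro ⟨c, hc, a, ha, hca, rfl⟩
    refine ⟨insert n c, hc, a, ha, ?_, (Finset.insert_union n c a).symm⟩
    exact Finset.forall_mem_insert _ _ _ |>.2
      ⟨fun y hy => hu y (Finset.mem_union_right c hy), hca⟩

theorem Uniform.join (hC : Uniform γ m C) (hA : Uniform α m A) :
    Uniform (α + γ) m (join C A) := by
  induction hC with
  | zero m C hC =>
    rw [add_zero]
    refine hA.congr fun s hs => ⟨fun h => ⟨∅, (hC ∅ (by simp)).2 rfl, s, h, by simp [BlockLT]⟩, ?_⟩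
    rintro ⟨c, hc, a, ha, -, rfl⟩
    obtain rfl : c = ∅ := (hC c fun x hx => hs x (Finset.mem_union_left a hx)).1 hc
    rwa [Finset.empty_union]
  | step γ m C f hC hlt hlim _ ih =>
    refine .step _ m _ (fun n => α + f n) ?_ (fun n hn => by simpa using hlt n hn) ?_ ?_
    · rintro ⟨c, hc, a, -, -, hca⟩
      rw [eq_comm, Finset.union_eq_empty] at hca
      exact hC (hca.1 ▸ hc)
    · intro η hη
      rcases lt_or_ge η α with h | h
      · exact .of_forall fun n => h.le.trans le_self_add
      · rw [← Ordinal.add_sub_cancel_of_le h, add_lt_add_iff_left] at hη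
        filter_upwards [hlim _ hη] with n hn
        rwa [← Ordinal.add_sub_cancel_of_le h, add_le_add_iff_left]
    · exact fun n hn => (ih n hn (hA.mono hn.le)).congr fun s hs => (mem_tail_join hC hs).symm

theorem uniform_chain_map {S : Ordinal.{0} → Set (Finset ℕ+)} {l : List Ordinal.{0}}
    (h : ∀ b ∈ l, Uniform (ω ^ b) 0 (S b)) : Uniform (sumPow l) 0 (chain (l.map S)) := by
  induction l with
  | nil => exact .zero 0 _ fun _ _ => Iff.rfl
  | cons b l ih =>
    rw [List.forall_mem_cons] at h
    rw [sumPow_cons]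
    exact (ih h.2).join h.1

theorem Uniform.tail_chain_replicate (hA : Uniform α 0 A) (hα : α ≠ 0)
    (htail : Uniform γ n (tail A n)) (k : ℕ) :
    Uniform (α * k + γ) n (tail (chain (List.replicate (k + 1) A)) n) := by
  induction k with
  | zero =>
    rw [Nat.cast_zero, mul_zero, zero_add]
    refine htail.congr fun s _ => ?_
    simp [chain, BlockRamsey.join, tail, BlockLT]
  | succ k ih =>
    have hempty : ∅ ∉ chain (List.replicate (k + 1) A) := by
      rintro ⟨c, -, a, ha, -, h⟩
      rw [eq_comm, Finset.union_eq_empty] at h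
      exact hA.empty_notMem hα (h.2 ▸ ha)
    have hcast : ((k + 1 : ℕ) : Ordinal.{0}) = 1 + k := by rw [add_comm, Nat.cast_add, Nat.cast_one]
    rw [hcast, mul_one_add, add_assoc]
    exact (ih.join (hA.mono n.1.zero_le)).congr fun s hs => (mem_tail_join hempty hs).symm

theorem mem_chain_ofFn {r : ℕ} {A : Fin r → Set (Finset ℕ+)} : u ∈ chain (List.ofFn A) ↔
    ∃ s : Fin r → Finset ℕ+, (∀ i j, i < j → BlockLT (s j) (s i)) ∧ (∀ i, s i ∈ A i) ∧
      u = Finset.univ.biUnion s := by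
  induction r generalizing u with
  | zero => simp [chain]
  | succ r ih =>
    have hunion (a : Finset ℕ+) (s : Fin r → Finset ℕ+) :
        Finset.univ.biUnion (Fin.cons a s : Fin (r + 1) → Finset ℕ+) =
          Finset.univ.biUnion s ∪ a := by
      ext x
      simp [Fin.exists_fin_succ, or_comm]
    have hlt (a : Finset ℕ+) (s : Fin r → Finset ℕ+) :
        BlockLT (Finset.univ.biUnion s) a ↔ ∀ i, BlockLT (s i) a := by
      simp only [BlockLT, Finset.mem_biUnion, Finset.mem_univ, true_and, forall_exists_index]
      exact forall_comm
    simp only [List.ofFn_succ, Fin.exists_fin_succ_pi, chain, BlockRamsey.join, ih,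
      Set.mem_ofPred_eq, Fin.forall_fin_succ, hunion, Fin.cons_zero, Fin.cons_succ,
      Fin.succ_pos, Fin.not_lt_zero, Fin.succ_lt_succ_iff, IsEmpty.forall_iff,
      forall_const, true_and]
    constructor
    · rintro ⟨_, ⟨s, hs, hsA, rfl⟩, a, ha, hca, rfl⟩
      exact ⟨a, s, ⟨(hlt a s).1 hca, hs⟩, ⟨ha, hsA⟩, rfl⟩
    · rintro ⟨a, s, ⟨hca, hs⟩, ⟨ha, hsA⟩, rfl⟩
      exact ⟨_, ⟨s, hs, hsA, rfl⟩, a, ha, (hlt a s).2 hca, rfl⟩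

theorem mem_chain_replicate {r : ℕ} : u ∈ chain (List.replicate r A) ↔
    ∃ s : Fin r → Finset ℕ+, (∀ i j, i < j → BlockLT (s i) (s j)) ∧ (∀ i, s i ∈ A) ∧
      u = Finset.univ.biUnion s := by
  rw [← List.ofFn_const, mem_chain_ofFn, Fin.rev_injective.surjective_comp_right.exists]
  have hunion (s : Fin r → Finset ℕ+) :
      Finset.univ.biUnion (s ∘ Fin.rev) = Finset.univ.biUnion s := by
    ext x
    simpa using (Fin.rev_surjective.exists (p := fun i => x ∈ s i)).symm
  refine exists_congr fun s => and_congr ⟨fun h i j hij => ?_, fun h i j hij => ?_⟩ <|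
    and_congr (Fin.rev_surjective.forall (p := fun i => s i ∈ A)).symm (by rw [hunion])
  · simpa using h j.rev i.rev (Fin.rev_lt_rev.2 hij)
  · exact h j.rev i.rev (Fin.rev_lt_rev.2 hij)

theorem Uniform.exists_tail_chain_replicate {β : Ordinal.{0}} (hA : Uniform (ω ^ β) 0 A) (n : ℕ+) :
    ∃ γ, ω ^ β * n.natPred ≤ γ ∧ γ < ω ^ (β + 1) ∧
      Uniform γ n (tail (chain (List.replicate n A)) n) := by
  have hβ : ω ^ β ≠ 0 := opow_ne_zero β omega0_ne_zero
  obtain ⟨γ, hγ, htail⟩ : ∃ γ < ω ^ β, Uniform γ n (tail A n) := by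
    generalize ω ^ β = α at hA hβ
    cases hA with
    | zero => exact absurd rfl hβ
    | step _ _ _ f _ hlt _ htail => exact ⟨f n, hlt n n.pos, htail n n.pos⟩
  have hlt : β < β + 1 := Order.lt_add_one_iff.2 le_rfl
  refine ⟨ω ^ β * n.natPred + γ, le_self_add, ?_, ?_⟩
  · exact isPrincipal_add_omega0_opow (β + 1) (opow_mul_lt_opow (natCast_lt_omega0 _) hlt)
      (hγ.trans ((opow_lt_opow_iff_right one_lt_omega0).2 hlt))
  · have h := hA.tail_chain_replicate hβ htail n.natPred
    rwa [n.natPred_add_one] at h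

end Uniform

section Schreier

variable {lam : Ordinal.{0} → ℕ+ → Ordinal.{0}} {ξ β : Ordinal.{0}} {l : List Ordinal.{0}}
  {u : Finset ℕ+}

/-- The family `𝒜_ξ`. -/
def schreierFamily (lam : Ordinal.{0} → ℕ+ → Ordinal.{0}) (ξ : Ordinal.{0}) : Set (Finset ℕ+) :=
  {s | Schreier lam ξ s}

theorem sum_ofFn_opow {r : ℕ} (b : Fin r → Ordinal.{0}) :
    (List.ofFn fun i => ω ^ b i).sum = sumPow (List.ofFn b) := by
  rw [sumPow, List.map_ofFn]
  rfl

theorem isSuccLimit_sum_ofFn_opow {r : ℕ} (hr : 2 ≤ r) {b : Fin r → Ordinal.{0}} (hb : Antitone b)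
    (hpos : ∀ i, 0 < b i) : Order.IsSuccLimit (List.ofFn fun i => ω ^ b i).sum := by
  rw [sum_ofFn_opow, isSuccLimit_sumPow_iff hb.sortedGE_ofFn.pairwise]
  exact ⟨by simp; omega, List.forall_mem_ofFn_iff.2 fun i => (hpos i).ne'⟩

theorem sum_ofFn_opow_ne_opow {r : ℕ} (hr : 2 ≤ r) {b : Fin r → Ordinal.{0}} (hb : Antitone b)
    (c : Ordinal.{0}) : (List.ofFn fun i => ω ^ b i).sum ≠ ω ^ c := by
  intro h
  have hc : ω ^ c = sumPow [c] := by simp [sumPow]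
  rw [sum_ofFn_opow, hc] at h
  have := congrArg List.length
    (sumPow_injective hb.sortedGE_ofFn.pairwise (List.pairwise_singleton _ c) h)
  simp at this
  omega

theorem schreierFamily_zero (lam : Ordinal.{0} → ℕ+ → Ordinal.{0}) :
    schreierFamily lam 0 = {∅} := by
  refine Set.Subset.antisymm (fun s h => ?_) (Set.singleton_subset_iff.2 .zero)
  rw [schreierFamily, Set.mem_ofPred_eq] at h
  generalize hξ : (0 : Ordinal.{0}) = ξ at h
  cases h with
  | zero => rfl
  | succ ζ => exact absurd hξ.symm (by simp)
  | powSucc β => exact absurd hξ.symm (opow_ne_zero _ omega0_ne_zero)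
  | powLimit l => exact absurd hξ.symm (opow_ne_zero _ omega0_ne_zero)
  | normalForm r hr b hb hpos =>
    exact absurd hξ.symm (isSuccLimit_sum_ofFn_opow hr hb hpos).ne_bot

theorem mem_schreierFamily_add_one : u ∈ schreierFamily lam (β + 1) ↔
    ∃ n s, (∀ x ∈ s, n < x) ∧ s ∈ schreierFamily lam β ∧ u = insert n s := by
  have hBlockLT (n : ℕ+) (s : Finset ℕ+) : BlockLT {n} s ↔ ∀ x ∈ s, n < x := by simp [BlockLT]
  refine ⟨fun h => ?_, fun ⟨n, s, hn, hs, hu⟩ => hu ▸ .succ β n s ((hBlockLT n s).2 hn) hs⟩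
  rw [schreierFamily, Set.mem_ofPred_eq] at h
  have hlim := Order.not_isSuccLimit_add_one β
  generalize hξ : β + 1 = ξ at h hlim
  cases h with
  | zero => exact absurd hξ (by simp)
  | succ ζ n s hn hs =>
    obtain rfl : β = ζ := Order.succ_injective hξ
    exact ⟨n, s, (hBlockLT n s).1 hn, hs, rfl⟩
  | powSucc β => exact absurd (isSuccLimit_omega0_opow (by simp)) hlim
  | powLimit l hl => exact absurd (isSuccLimit_omega0_opow hl.ne_bot) hlim
  | normalForm r hr b hb hpos => exact absurd (isSuccLimit_sum_ofFn_opow hr hb hpos) hlim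

theorem mem_schreierFamily_opow_of_isSuccLimit (hβ : Order.IsSuccLimit β) :
    u ∈ schreierFamily lam (ω ^ β) ↔
      ∃ n, IsLeast (u : Set ℕ+) n ∧ u ∈ schreierFamily lam (ω ^ lam β n) := by
  refine ⟨fun h => ?_, fun ⟨n, hn, hu⟩ => .powLimit β hβ n u hn hu⟩
  rw [schreierFamily, Set.mem_ofPred_eq] at h
  have hlim := isSuccLimit_omega0_opow hβ.ne_bot
  generalize hξ : ω ^ β = ξ at h hlim
  cases h with
  | zero => exact absurd rfl hlim.ne_bot
  | succ ζ => exact absurd hlim (Order.not_isSuccLimit_add_one ζ)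
  | powSucc β' =>
    rw [opow_right_inj one_lt_omega0] at hξ
    exact absurd (hξ ▸ hβ) (Order.not_isSuccLimit_add_one β')
  | powLimit l _ n _ hn hs =>
    rw [opow_right_inj one_lt_omega0] at hξ
    exact ⟨n, hn, hξ ▸ hs⟩
  | normalForm r hr b hb => exact absurd hξ.symm (sum_ofFn_opow_ne_opow hr hb β)

theorem isLeast_biUnion_iff {r : ℕ} (hr : 0 < r) {s : Fin r → Finset ℕ+} {n : ℕ+}
    (hlt : ∀ i j, i < j → BlockLT (s i) (s j)) (hne : (s ⟨0, hr⟩).Nonempty) :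
    IsLeast (Finset.univ.biUnion s : Set ℕ+) n ↔ IsLeast (s ⟨0, hr⟩ : Set ℕ+) n := by
  have hmem {i x} (hx : x ∈ s i) : x ∈ Finset.univ.biUnion s :=
    Finset.mem_biUnion.2 ⟨i, Finset.mem_univ i, hx⟩
  have hzero_le (i : Fin r) : ⟨0, hr⟩ ≤ i := Fin.le_def.2 i.1.zero_le
  constructor
  · rintro ⟨hn, hle⟩
    refine ⟨?_, fun x hx => hle (hmem hx)⟩
    obtain ⟨i, -, hi⟩ := Finset.mem_biUnion.1 hn
    rcases (hzero_le i).eq_or_lt with rfl | h0i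
    · exact hi
    · obtain ⟨y, hy⟩ := hne
      exact absurd (hle (hmem hy)) (hlt _ i h0i y hy n hi).not_ge
  · rintro ⟨hn, hle⟩
    refine ⟨hmem hn, fun x hx => ?_⟩
    obtain ⟨i, -, hi⟩ := Finset.mem_biUnion.1 hx
    rcases (hzero_le i).eq_or_lt with rfl | h0i
    · exact hle hi
    · exact (hlt _ i h0i n hn x hi).le

theorem mem_schreierFamily_opow_add_one (hβ : ∅ ∉ schreierFamily lam (ω ^ β)) :
    u ∈ schreierFamily lam (ω ^ (β + 1)) ↔ ∃ n : ℕ+, IsLeast (u : Set ℕ+) n ∧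
      u ∈ chain (List.replicate n (schreierFamily lam (ω ^ β))) := by
  have hne {s} (hs : s ∈ schreierFamily lam (ω ^ β)) : s.Nonempty :=
    Finset.nonempty_iff_ne_empty.2 (ne_of_mem_of_not_mem hs hβ)
  simp only [mem_chain_replicate]
  constructor
  · intro h
    rw [schreierFamily, Set.mem_ofPred_eq] at h
    have hlim := isSuccLimit_omega0_opow (b := β + 1) (by simp)
    generalize hξ : ω ^ (β + 1) = ξ at h hlim
    cases h with
    | zero => exact absurd rfl hlim.ne_bot
    | succ ζ => exact absurd hlim (Order.not_isSuccLimit_add_one ζ)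
    | powSucc β' n s hmin hlt hs =>
      rw [opow_right_inj one_lt_omega0] at hξ
      obtain rfl : β = β' := Order.succ_injective hξ
      exact ⟨n, (isLeast_biUnion_iff n.pos hlt (hne (hs _))).2 hmin, s, hlt, hs, rfl⟩
    | powLimit l hl =>
      rw [opow_right_inj one_lt_omega0] at hξ
      exact absurd (hξ ▸ hl) (Order.not_isSuccLimit_add_one β)
    | normalForm r hr b hb => exact absurd hξ.symm (sum_ofFn_opow_ne_opow hr hb _)
  · rintro ⟨n, hn, s, hlt, hs, rfl⟩
    exact .powSucc β n s ((isLeast_biUnion_iff n.pos hlt (hne (hs _))).1 hn) hlt hs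

theorem schreierFamily_sumPow_of_two_le_length (hl : l.Pairwise (· ≥ ·)) (hpos : ∀ b ∈ l, b ≠ 0)
    (hlen : 2 ≤ l.length) :
    schreierFamily lam (sumPow l) = chain (l.map fun b => schreierFamily lam (ω ^ b)) := by
  ext u
  constructor
  · intro h
    have hlim := (isSuccLimit_sumPow_iff hl).2 ⟨by rintro rfl; simp at hlen, hpos⟩
    have hne := sum_ofFn_opow_ne_opow hlen (List.sortedGE_iff_pairwise.2 hl).antitone_get
    rw [sum_ofFn_opow, List.ofFn_get] at hne
    rw [schreierFamily, Set.mem_ofPred_eq] at h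
    generalize hξ : sumPow l = ξ at h hlim hne
    cases h with
    | zero => exact absurd rfl hlim.ne_bot
    | succ ζ => exact absurd hlim (Order.not_isSuccLimit_add_one ζ)
    | powSucc β => exact absurd rfl (hne _)
    | powLimit β => exact absurd rfl (hne _)
    | normalForm r hr b hb _ s hlt hs =>
      rw [sum_ofFn_opow] at hξ
      rw [sumPow_injective hl hb.sortedGE_ofFn.pairwise hξ, List.map_ofFn, mem_chain_ofFn]
      exact ⟨s, hlt, hs, rfl⟩
  · intro h
    rw [← l.ofFn_get, List.map_ofFn, mem_chain_ofFn] at h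
    obtain ⟨s, hlt, hs, rfl⟩ := h
    have := Schreier.normalForm l.length hlen l.get (List.sortedGE_iff_pairwise.2 hl).antitone_get
      (fun i => pos_iff_ne_zero.2 (hpos _ (l.get_mem i))) s hlt hs
    rwa [sum_ofFn_opow, List.ofFn_get] at this

theorem schreierFamily_sumPow (hl : l.Pairwise (· ≥ ·)) (hpos : ∀ b ∈ l, b ≠ 0) :
    schreierFamily lam (sumPow l) = chain (l.map fun b => schreierFamily lam (ω ^ b)) := by
  rcases l with _ | ⟨b, _ | ⟨c, l⟩⟩
  · exact schreierFamily_zero lam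
  · ext u
    simp [sumPow, chain, join, BlockLT]
  · exact schreierFamily_sumPow_of_two_le_length hl hpos (by simp)

theorem Uniform.schreierFamily_add_one (h : Uniform ξ 0 (schreierFamily lam ξ)) :
    Uniform (ξ + 1) 0 (schreierFamily lam (ξ + 1)) := by
  have hlt : ξ < ξ + 1 := Order.lt_add_one_iff.2 le_rfl
  refine .step _ 0 _ (fun _ => ξ) (fun h => ?_) (fun _ _ => hlt)
    (fun η hη => .of_forall fun _ => Order.lt_add_one_iff.1 hη)
    fun n hn => (h.mono hn.le).congr fun s hs => ⟨fun h => ?_, ?_⟩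
  · obtain ⟨n, t, -, -, h⟩ := mem_schreierFamily_add_one.1 h
    exact Finset.insert_ne_empty n t h.symm
  · exact mem_schreierFamily_add_one.2 ⟨n, s, hs, h, rfl⟩
  · intro h
    obtain ⟨k, t, hk, ht, he⟩ := mem_schreierFamily_add_one.1 h
    obtain rfl : n = k := (isLeast_insert hs).unique (he ▸ isLeast_insert hk)
    rwa [← Finset.erase_insert fun h => lt_irrefl n (hs n h), he,
      Finset.erase_insert fun h => lt_irrefl n (hk n h)]

theorem Uniform.schreierFamily_opow_add_one
    (h : Uniform (ω ^ β) 0 (schreierFamily lam (ω ^ β))) :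
    Uniform (ω ^ (β + 1)) 0 (schreierFamily lam (ω ^ (β + 1))) := by
  choose f hle hlt htail using h.exists_tail_chain_replicate
  have hempty := h.empty_notMem (opow_ne_zero β omega0_ne_zero)
  refine .of_isLeast (fun u => mem_schreierFamily_opow_add_one hempty) hlt (fun η hη => ?_) htail
  obtain ⟨N, hN⟩ := lt_omega0_opow_succ.1 hη
  filter_upwards [eventually_ge_atTop N.succPNat] with n hn
  have hNn : N ≤ n.natPred := N.natPred_succPNat ▸ PNat.natPred_le_natPred.2 hn
  exact hN.le.trans ((mul_le_mul_right (Nat.cast_le.2 hNn) _).trans (hle n))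

theorem uniform_schreierFamily_opow_of_isSuccLimit (hlam : IsLadderSystem lam)
    (hβ : Order.IsSuccLimit β) (hβω : β < ω₁)
    (h : ∀ b < β, Uniform (ω ^ b) 0 (schreierFamily lam (ω ^ b))) :
    Uniform (ω ^ β) 0 (schreierFamily lam (ω ^ β)) := by
  obtain ⟨hmono, hsucc, hlt, hlub⟩ := hlam β hβ hβω
  choose b hb using hsucc
  have hbβ (n : ℕ+) : b n + 1 < β := hb n ▸ hlt n
  have hu (n : ℕ+) := h (b n) ((Order.lt_add_one_iff.2 le_rfl).trans (hbβ n))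
  choose f hle hflt htail using fun n => (hu n).exists_tail_chain_replicate n
  refine .of_isLeast (f := f) (fun u => ?_) (fun n => ?_) (fun η hη => ?_) htail
  · rw [mem_schreierFamily_opow_of_isSuccLimit hβ]
    refine exists_congr fun n => and_congr_right fun hn => ?_
    rw [hb, mem_schreierFamily_opow_add_one ((hu n).empty_notMem (opow_ne_zero _ omega0_ne_zero))]
    exact ⟨fun ⟨k, hk, h⟩ => hn.unique hk ▸ h, fun h => ⟨n, hn, h⟩⟩
  · exact (hflt n).trans ((opow_lt_opow_iff_right one_lt_omega0).2 (hbβ n))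
  · obtain ⟨δ, hδ, hηδ⟩ := (lt_opow_of_isSuccLimit omega0_ne_zero hβ).1 hη
    obtain ⟨_, ⟨N, rfl⟩, hN⟩ := (lt_isLUB_iff hlub).1 hδ
    filter_upwards [eventually_ge_atTop N, eventually_ge_atTop 2] with n hNn hn
    have hδb : δ ≤ b n := Order.lt_add_one_iff.1 (hb n ▸ hN.trans_le (hmono.monotone hNn))
    have h1n : 1 ≤ n.natPred := PNat.natPred_le_natPred.2 hn
    calc η ≤ ω ^ δ := hηδ.le
      _ ≤ ω ^ b n := opow_le_opow_right omega0_pos hδb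
      _ = ω ^ b n * (1 : ℕ) := by rw [Nat.cast_one, mul_one]
      _ ≤ ω ^ b n * n.natPred := mul_le_mul_right (Nat.cast_le.2 h1n) _
      _ ≤ f n := hle n

theorem uniform_schreierFamily_opow (hlam : IsLadderSystem lam) (hβ : β < ω₁) :
    Uniform (ω ^ β) 0 (schreierFamily lam (ω ^ β)) := by
  induction β using Ordinal.limitRecOn with
  | zero =>
    have h : Uniform (0 + 1) 0 (schreierFamily lam (0 + 1)) :=
      Uniform.schreierFamily_add_one (.zero 0 _ fun s _ => by rw [schreierFamily_zero]; rfl)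
    rwa [zero_add, ← opow_zero ω] at h
  | add_one β ih =>
    exact (ih ((Order.lt_add_one_iff.2 le_rfl).trans hβ)).schreierFamily_opow_add_one
  | limit β hlim ih =>
    exact uniform_schreierFamily_opow_of_isSuccLimit hlam hlim hβ
      fun b hb => ih b hb (hb.trans hβ)

theorem uniform_schreierFamily (hlam : IsLadderSystem lam) (hξ : ξ < ω₁) :
    Uniform ξ 0 (schreierFamily lam ξ) := by
  induction ξ using Ordinal.limitRecOn with
  | zero => exact .zero 0 _ fun s _ => by rw [schreierFamily_zero]; rfl
  | add_one ξ ih => exact (ih ((Order.lt_add_one_iff.2 le_rfl).trans hξ)).schreierFamily_add_one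
  | limit ξ hlim =>
    obtain ⟨l, hl, rfl⟩ := exists_sumPow ξ
    rw [schreierFamily_sumPow hl ((isSuccLimit_sumPow_iff hl).1 hlim).2]
    refine uniform_chain_map fun b hb => uniform_schreierFamily_opow hlam ?_
    exact ((right_le_opow b one_lt_omega0).trans (opow_le_sumPow hb)).trans_lt hξ

end Schreier

theorem Uniform.frontRank {A : Set (Finset ℕ+)} {B : Set (Finset (Finset ℕ+))} {α : Ordinal.{0}}
    {m : ℕ} {s : Finset (Finset ℕ+)} (h : Uniform α m A) (hs : s ∈ FinColl)
    (hm : ∀ v, v.Nonempty → Beyond s v → m < blockMin v)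
    (hsB : ∀ c, (∀ u ∈ c, Beyond s u) →
      (s ∪ c ∈ B ↔ s ∪ c ∈ FinColl ∧ c.image blockMin ∈ A)) : FrontRank B α s := by
  have hs₀ : s ∈ B ↔ ∅ ∈ A := by simpa [hs] using hsB ∅ (by simp)
  induction h generalizing s with
  | zero m A hA =>
    refine .leaf s (hs₀.2 ((hA ∅ (by simp)).2 rfl)) fun c hc hne hsc hB => hne.ne_empty ?_
    refine Finset.image_eq_empty.1 ((hA _ ?_).1 ((hsB c hsc).1 hB).2)
    exact Finset.forall_mem_image.2 fun u hu => hm u (hc.1 u hu) (hsc u hu)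
  | step α m A f hA hlt hlim _ ih =>
    refine .node α s (fun v => f (blockMin v)) (fun h => hA (hs₀.1 h))
      (fun v hv hsv => hlt _ (hm v hv hsv)) (fun η hη => tendsto_comap.eventually (hlim η hη))
      fun v hv hsv => ?_
    have hvm : ∀ w, w.Nonempty → Beyond (insert v s) w → (blockMin v : ℕ) < blockMin w :=
      fun w hw hvw => (hvw v (Finset.mem_insert_self v s)).blockMin_lt hv hw
    have hvB : ∀ c, (∀ u ∈ c, Beyond (insert v s) u) → (insert v s ∪ c ∈ B ↔
        insert v s ∪ c ∈ FinColl ∧ c.image blockMin ∈ tail A (blockMin v)) := by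
      intro c hc
      have hsc : ∀ u ∈ insert v c, Beyond s u := Finset.forall_mem_insert _ _ _ |>.2
        ⟨hsv, fun u hu w hw => hc u hu w (Finset.mem_insert_of_mem hw)⟩
      rw [Finset.insert_union, ← Finset.union_insert, hsB _ hsc, Finset.image_insert]
      rfl
    refine ih _ (hm v hv hsv) (insert_mem_FinColl hs hv hsv) hvm hvB ?_
    simpa [insert_mem_FinColl hs hv hsv] using hvB ∅ (by simp)

theorem frontRank_blockSchreier {lam : Ordinal.{0} → ℕ+ → Ordinal.{0}} {ξ : Ordinal.{0}}
    (hlam : IsLadderSystem lam) (hξ : ξ < ω₁) : FrontRank (BlockSchreier lam ξ) ξ ∅ := by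
  refine (uniform_schreierFamily hlam hξ).frontRank empty_mem_FinColl
    (fun v _ _ => (blockMin v).pos) fun c _ => ?_
  rw [Finset.empty_union]
  rfl

section Examples

variable {a k : ℕ} {D : InfColl} {s t : Finset (Finset ℕ+)} {v : Finset ℕ+}
  {lam : Ordinal.{0} → ℕ+ → Ordinal.{0}}

/-- The finite disjoint collections with at most `min s₁ - a` members, written additively to avoid
truncated subtraction. For `a = 0` these are the Schreier admissible collections. Members of `ℬ^ω`
have exactly `min s₁` members, so they attain the bound for `a = 0` and violate it for `a = 1`. -/
def admissible (a : ℕ) : Set (Finset (Finset ℕ+)) :=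
  {s | s ∈ FinColl ∧ ∀ u ∈ s, s.card + a ≤ blockMin u}

theorem empty_mem_admissible (a : ℕ) : ∅ ∈ admissible a := ⟨empty_mem_FinColl, by simp⟩

theorem insert_mem_admissible_iff (hs : s ∈ FinColl) (hv : v.Nonempty) (h : Beyond s v) :
    insert v s ∈ admissible a ↔ s ∈ admissible (a + 1) ∧ s.card + (a + 1) ≤ blockMin v := by
  simp only [admissible, Set.mem_ofPred_eq, insert_mem_FinColl hs hv h, hs, true_and,
    Finset.card_insert_of_notMem (h.notMem hv), Finset.forall_mem_insert, add_right_comm _ 1 a,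
    add_assoc, and_comm]

theorem card_le_of_forall_mem_FU (ht : t ∈ FinColl) (h : ∀ u ∈ t, u ∈ FU (s : Set (Finset ℕ+))) :
    t.card ≤ s.card := by
  have hsub : ∀ u ∈ t, ∃ v ∈ s, v.Nonempty ∧ v ⊆ u := by
    intro u hu
    obtain ⟨J, -, hJs, rfl⟩ := h u hu
    obtain ⟨x, hx⟩ := ht.1 _ hu
    obtain ⟨v, hv, hxv⟩ := Finset.mem_biUnion.1 hx
    exact ⟨v, hJs v hv, ⟨x, hxv⟩, Finset.subset_biUnion_of_mem id hv⟩
  choose! f hf hne hfu using hsub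
  refine Finset.card_le_card_of_injOn f hf fun u hu v hv huv => ?_
  by_contra huv'
  obtain ⟨x, hx⟩ := hne u hu
  have hxu : x ∈ u := hfu u hu hx
  have hxv : x ∈ v := hfu v hv (huv ▸ hx)
  exact (ht.2 u hu v hv huv').elim (fun h => (h x hxu x hxv).false) fun h => (h x hxv x hxu).false

theorem isHereditary_admissible (a : ℕ) : IsHereditary (admissible a) := by
  refine IsDownClosed.isHereditary (fun s hs t ht hts => ⟨ht, fun u hu => ?_⟩)
    (empty_mem_admissible a) fun s hs => hs.1
  obtain ⟨J, -, hJ, rfl⟩ := hts u hu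
  obtain ⟨v, hv, hmin⟩ := Finset.mem_biUnion.1 (blockMin_mem (ht.1 _ hu))
  calc t.card + a ≤ s.card + a := Nat.add_le_add_right (card_le_of_forall_mem_FU ht hts) a
    _ ≤ blockMin v := hs.2 v (hJ v hv)
    _ ≤ blockMin (J.biUnion id) := PNat.coe_le_coe _ _ |>.2 (blockMin_le hmin)

theorem pointwiseClosed_admissible (a : ℕ) (D : InfColl) :
    PointwiseClosed (admissible a ∩ FinCollOf D) := by
  by_contra h
  obtain ⟨D₁, -, hD₁⟩ := (isHereditary_admissible a).isDownClosed.exists_FinCollOf_subset h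
  have hle := (hD₁ (image_range_mem_FinCollOf D₁ (blockMin (D₁.seq 0) + 1))).2 (D₁.seq 0)
    (Finset.mem_image_of_mem _ (by simp))
  rw [Finset.card_image_of_injective _ D₁.injective_seq, Finset.card_range] at hle
  omega

theorem mem_iterDeriv_admissible_iff (hs : s ∈ FinCollOf D) :
    s ∈ iterDeriv D (admissible a) k ↔ s ∈ admissible (a + k) := by
  induction k generalizing s with
  | zero => simp [mem_iterDeriv_iff]
  | succ k ih =>
    have hins : ∀ᶠ v in D.far, insert v s ∈ iterDeriv D (admissible a) k ↔
        s ∈ admissible (a + (k + 1)) := by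
      filter_upwards [D.eventually_mem_FU, D.eventually_beyond s, D.far_le
        (eventually_lt_blockMin (s.card + (a + k)).succPNat)] with v hv hsv hlt
      rw [ih (insert_mem_FinCollOf hs hv hsv),
        insert_mem_admissible_iff hs.1 (InfColl.nonempty_of_mem_FU hv) hsv]
      exact and_iff_left (PNat.coe_lt_coe _ _ |>.2 hlt).le
    rw [Nat.cast_add_one]
    refine ⟨fun h => ?_, fun h => ?_⟩
    · obtain ⟨v, hv, hiff⟩ :=
        ((eventually_insert_mem_iterDeriv h (lt_add_one _)).and hins).exists
      exact hiff.1 hv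
    · refine (isHereditary_admissible a).isDownClosed.mem_iterDeriv
        ⟨h.1, fun u hu => le_trans (by omega) (h.2 u hu)⟩ hs fun η hη => ?_
      filter_upwards [hins] with v hv
      exact iterDeriv_antitone D _ (Order.lt_add_one_iff.1 hη) (hv.2 h)

theorem iterDeriv_admissible_eq_empty (a : ℕ) (D : InfColl) :
    iterDeriv D (admissible a) (ω + 1) = ∅ := by
  by_contra hne
  have hmem := (isHereditary_admissible a).isDownClosed.empty_mem_iterDeriv_iff.2 hne
  obtain ⟨v, hvω, hv⟩ := ((eventually_insert_mem_iterDeriv hmem (lt_add_one ω)).and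
    D.eventually_mem_FU).exists
  have hvD : insert v ∅ ∈ FinCollOf D :=
    insert_mem_FinCollOf (empty_mem_FinCollOf D) hv (by simp [Beyond])
  have hle := ((mem_iterDeriv_admissible_iff hvD).1
    (iterDeriv_antitone D _ (natCast_lt_omega0 (blockMin v)).le hvω)).2 v (by simp)
  simp only [Finset.card_insert_of_notMem (Finset.notMem_empty v), Finset.card_empty] at hle
  omega

theorem empty_mem_iterDeriv_omega0_admissible (a : ℕ) (D : InfColl) :
    ∅ ∈ iterDeriv D (admissible a) ω := by
  refine (isHereditary_admissible a).isDownClosed.mem_iterDeriv (empty_mem_admissible a)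
    (empty_mem_FinCollOf D) fun η hη => ?_
  obtain ⟨k, rfl⟩ := lt_omega0.1 hη
  have hmem : ∅ ∈ iterDeriv D (admissible a) (k + 1 : ℕ) :=
    (mem_iterDeriv_admissible_iff (empty_mem_FinCollOf D)).2 (empty_mem_admissible _)
  exact eventually_insert_mem_iterDeriv hmem (Nat.cast_lt.2 k.lt_succ_self)

theorem supIndex_admissible (a : ℕ) (D : InfColl) : supIndex D (admissible a) = ω + 1 := by
  have hempty := fun D₁ (_ : D₁.Below D) => iterDeriv_admissible_eq_empty a D₁
  refine (supIndex_le hempty).antisymm (Order.add_one_le_of_lt ?_)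
  exact (lt_supIndex_iff hempty (isHereditary_admissible a).isDownClosed).2
    ⟨D, .refl D, empty_mem_iterDeriv_omega0_admissible a D⟩

theorem card_of_mem_chain_replicate {A : Set (Finset ℕ+)} {u : Finset ℕ+} {m r : ℕ}
    (hA : ∀ w ∈ A, w.card = m) (hu : u ∈ chain (List.replicate r A)) : u.card = r * m := by
  obtain ⟨w, hlt, hw, rfl⟩ := mem_chain_replicate.1 hu
  have hdisj : ∀ i j, i < j → Disjoint (w i) (w j) := fun i j hij =>
    Finset.disjoint_left.2 fun x hxi hxj => (hlt i j hij x hxi x hxj).false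
  rw [Finset.card_biUnion fun i _ j _ hij => hij.lt_or_gt.elim (hdisj i j) fun h =>
    (hdisj j i h).symm]
  simp [hA _ (hw _)]

theorem exists_isLeast_card_of_mem_schreierFamily_omega0 {u : Finset ℕ+}
    (hu : u ∈ schreierFamily lam ω) : ∃ n : ℕ+, IsLeast (u : Set ℕ+) n ∧ u.card = n := by
  have hone : ∀ w ∈ schreierFamily lam (ω ^ (0 : Ordinal.{0})), w.card = 1 := by
    intro w hw
    rw [opow_zero, ← zero_add 1, mem_schreierFamily_add_one] at hw
    obtain ⟨n, s, -, hs, rfl⟩ := hw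
    obtain rfl : s = ∅ := by rwa [schreierFamily_zero] at hs
    rfl
  rw [← opow_one ω, ← zero_add 1,
    mem_schreierFamily_opow_add_one fun h => by simpa using hone ∅ h] at hu
  obtain ⟨n, hn, hchain⟩ := hu
  exact ⟨n, hn, by simpa using card_of_mem_chain_replicate hone hchain⟩

theorem exists_isLeast_card_of_mem_blockSchreier_omega0 (hs : s ∈ BlockSchreier lam ω) :
    ∃ n : ℕ+, IsLeast (blockMin '' s) n ∧ s.card = n := by
  obtain ⟨n, hn, hcard⟩ := exists_isLeast_card_of_mem_schreierFamily_omega0 hs.2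
  refine ⟨n, by simpa using hn, ?_⟩
  rw [← hcard, Finset.card_image_of_injOn]
  intro u hu v hv huv
  by_contra hne
  exact ((blockLT_of_blockMin_le hs.1 hu hv hne huv.le).blockMin_lt (hs.1.1 u hu)
    (hs.1.1 v hv)).ne huv

theorem blockSchreier_omega0_subset_admissible : BlockSchreier lam ω ⊆ admissible 0 := by
  intro s hs
  obtain ⟨n, hn, hcard⟩ := exists_isLeast_card_of_mem_blockSchreier_omega0 hs
  exact ⟨hs.1, fun u hu => hcard.trans_le (hn.2 (Set.mem_image_of_mem _ hu))⟩

theorem blockSchreier_omega0_subset_sdiff_admissible :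
    BlockSchreier lam ω ⊆ FinColl \ admissible 1 := by
  intro s hs
  obtain ⟨_, ⟨⟨u, hu, rfl⟩, -⟩, hcard⟩ := exists_isLeast_card_of_mem_blockSchreier_omega0 hs
  exact ⟨hs.1, fun h => (Nat.lt_succ_self _).not_ge (hcard ▸ h.2 u hu)⟩

end Examples

end BlockRamsey

open BlockRamsey in
theorem theorem3p1 (lam : Ordinal.{0} → ℕ+ → Ordinal.{0}) (hlam : IsLadderSystem lam) :
    (∀ (F : Set (Finset (Finset ℕ+))) (D : InfColl), IsHereditary F →
      (¬ PointwiseClosed (F ∩ FinCollOf D) →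
        ∃ D₁ : InfColl, D₁.Below D ∧ FinCollOf D₁ ⊆ F) ∧
      (PointwiseClosed (F ∩ FinCollOf D) →
        (∀ D₁ : InfColl, D₁.Below D →
          ∃ ζ : Ordinal.{0}, ζ < Ordinal.omega 1 ∧ iterDeriv D₁ F ζ = ∅) ∧
        supIndex D F < Ordinal.omega 1 ∧
        ∀ ξ : Ordinal.{0}, ξ < Ordinal.omega 1 →
          (ξ + 1 < supIndex D F →
            ∃ D₂ : InfColl, D₂.Below D ∧ BlockSchreier lam ξ ∩ FinCollOf D₂ ⊆ F) ∧
          (supIndex D F < ξ + 1 →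
            ∀ D₁ : InfColl, D₁.Below D →
              (∃ D₂ : InfColl, D₂.Below D₁ ∧
                BlockSchreier lam ξ ∩ FinCollOf D₂ ⊆ FinColl \ F) ∧
              (∀ D₂ : InfColl, D₂.Below D₁ →
                (BlockSchreier lam ξ ∩ FinCollOf D₂ ⊆ FinColl \ F ↔
                  F ∩ FinCollOf D₂ ⊆
                    initialClosure (BlockSchreier lam ξ) \ BlockSchreier lam ξ))) ∧
          (ξ + 1 = supIndex D F →
            ∃ D₂ : InfColl, D₂.Below D ∧
              (BlockSchreier lam ξ ∩ FinCollOf D₂ ⊆ F ∨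
                BlockSchreier lam ξ ∩ FinCollOf D₂ ⊆ FinColl \ F)))) ∧
    (∃ (D : InfColl) (F : Set (Finset (Finset ℕ+))), IsHereditary F ∧
      PointwiseClosed (F ∩ FinCollOf D) ∧ Ordinal.omega0 + 1 = supIndex D F ∧
      ∀ D₂ : InfColl, D₂.Below D →
        BlockSchreier lam Ordinal.omega0 ∩ FinCollOf D₂ ⊆ F) ∧
    (∃ (D : InfColl) (F : Set (Finset (Finset ℕ+))), IsHereditary F ∧
      PointwiseClosed (F ∩ FinCollOf D) ∧ Ordinal.omega0 + 1 = supIndex D F ∧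
      ∀ D₂ : InfColl, D₂.Below D →
        BlockSchreier lam Ordinal.omega0 ∩ FinCollOf D₂ ⊆ FinColl \ F) := by
  refine ⟨fun F D hF => ⟨hF.isDownClosed.exists_FinCollOf_subset, fun hclosed => ?_⟩, ?_, ?_⟩
  · have hF := hF.isDownClosed
    obtain ⟨α, hα, hempty⟩ := hclosed.exists_iterDeriv_eq_empty hF
    refine ⟨fun D₁ hD₁ => ⟨α, hα, hempty D₁ hD₁⟩, (supIndex_le hempty).trans_lt hα, fun ξ hξ => ?_⟩
    have hB := frontRank_blockSchreier hlam hξ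
    exact ⟨hB.exists_subset_of_lt_supIndex hempty hF,
      fun hlt D₁ hD₁ => ⟨hB.exists_subset_sdiff_of_supIndex_lt hempty hF hlt hD₁,
        fun D₂ _ => hB.subset_sdiff_iff hF D₂⟩,
      fun _ => hB.exists_homogeneous F D⟩
  · obtain ⟨D⟩ := nonempty_infColl
    exact ⟨D, admissible 0, isHereditary_admissible 0, pointwiseClosed_admissible 0 D,
      (supIndex_admissible 0 D).symm,
      fun _ _ => Set.inter_subset_left.trans blockSchreier_omega0_subset_admissible⟩
  · obtain ⟨D⟩ := nonempty_infColl
    exact ⟨D, admissible 1, isHereditary_admissible 1, pointwiseClosed_admissible 1 D,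
      (supIndex_admissible 1 D).symm,
      fun _ _ => Set.inter_subset_left.trans blockSchreier_omega0_subset_sdiff_admissible⟩
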